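/- All graphs are finite and simple. For a graph $G$ let $Q(G)=D(G)+A(G)$ be its signless Laplacian matrix (degree matrix plus adjacency matrix) and $q_{\min}(G)$ the least eigenvalue of $Q(G)$. The domination number of $G$ is the least size of a vertex set $D$ such that every vertex outside $D$ has a neighbour in $D$. A unicyclic graph is a connected graph with as many edges as vertices. A pendant vertex is a vertex of degree $1$, and a support vertex is a vertex adjacent to a pendant vertex. For $g\ge 3$ and $l\ge 1$ the lollipop graph $L_{g,l}$ consists of the cycle $v_1v_2\cdots v_gv_1$ and the path $v_gv_{g+1}\cdots v_{g+l}$, with $v_1,\dots,v_{g+l}$ distinct. A graph of order $n$ is an $\mathcal F_{g,l}$-graph if it is obtained from $L_{g,l}$ by attaching $n-g-l$ pendant vertices to some of the nonpendant vertices $v_1,\dots,v_{g+l-1}$ of $L_{g,l}$, in such a way that in the resulting graph every vertex other than $v_{g+l-1}$ is adjacent to at most one pendant vertex. A choice of vertices $v_1,\dots,v_{g+l}$ of $G$ that exhibits $G$ in this form is called an $\mathcal F_{g,l}$-labelling of $G$. **Theorem.** Let $n,\gamma,g$ be such that $g\le n-1$ and the class $\mathcal U$ of nonbipartite unicyclic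 graphs of order $n$ with domination number $\gamma$ and girth $g$ is nonempty. Then the minimum of $q_{\min}$ over $\mathcal U$ is attained at some graph that is an $\mathcal F_{g,l}$-graph for some $l\ge1$. Moreover, let $G\in\mathcal U$ be any graph at which the minimum is attained. Then there is an $l\ge 1$ such that $G$ is an $\mathcal F_{g,l}$-graph and, for every unit eigenvector $x$ of $Q(G)$ for the eigenvalue $q_{\min}(G)$: 1. there is an $\mathcal F_{g,l}$-labelling $v_1,\dots,v_{g+l}$ of $G$ such that $$|x_{v_g}|>0\quad\text{and}\quad |x_{v_{g+l-1}}|=\max\{|x_w| : w \text{ a support vertex of } G\};\qquad(*)$$ 2. $(*)$ holds for every $\mathcal F_{g,l}$-labelling $v_1,\dots,v_{g+l}$ of $G$ for which $l\ge 2$ or $v_g$ is adjacent to at least two pendant vertices. -/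

import Mathlib

namespace SimpleGraph

open Matrix

variable {V : Type*}

/-- `D` is a dominating set: every vertex outside `D` has a neighbour in `D`. -/
def IsDominatingSet (G : SimpleGraph V) (D : Finset V) : Prop :=
  ∀ v, v ∉ D → ∃ u ∈ D, G.Adj v u

/-- The domination number: the least cardinality of a dominating set. -/
noncomputable def dominationNumber (G : SimpleGraph V) : ℕ :=
  sInf {k | ∃ D : Finset V, G.IsDominatingSet D ∧ D.card = k}

/-- A pendant vertex: a vertex of degree one. -/
def IsPendant (G : SimpleGraph V) (v : V) : Prop :=
  (G.neighborSet v).ncard = 1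

/-- The pendant vertices adjacent to `v`. -/
def pendantNeighborSet (G : SimpleGraph V) (v : V) : Set V :=
  {u | G.Adj v u ∧ G.IsPendant u}

/-- A support vertex (`p`-dominator): a vertex adjacent to a pendant vertex. -/
def IsSupport (G : SimpleGraph V) (v : V) : Prop :=
  (G.pendantNeighborSet v).Nonempty

/-- A unicyclic graph: connected, with as many edges as vertices. -/
def IsUnicyclic (G : SimpleGraph V) : Prop :=
  G.Connected ∧ G.edgeSet.ncard = Nat.card V

open Classical in
/-- The signless Laplacian matrix `Q(G) = D(G) + A(G)`. -/
noncomputable def signlessLapMatrix [Fintype V] [DecidableEq V] (G : SimpleGraph V) : Matrix V V ℝ :=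
  G.degMatrix ℝ + G.adjMatrix ℝ

/-- The least eigenvalue of the signless Laplacian matrix. -/
noncomputable def qMin [Fintype V] [DecidableEq V] (G : SimpleGraph V) : ℝ :=
  sInf (spectrum ℝ G.signlessLapMatrix)

/-- `x` is a unit eigenvector of the signless Laplacian for its least eigenvalue. -/
def IsUnitQMinEigenvector [Fintype V] [DecidableEq V] (G : SimpleGraph V)
    (x : V → ℝ) : Prop :=
  G.signlessLapMatrix *ᵥ x = G.qMin • x ∧ ∑ i, x i ^ 2 = 1

/-- The lollipop graph `L_{g,l}` on the vertices `1, …, g + l`: the cycle `1, 2, …, g, 1`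
together with the path `g, g + 1, …, g + l`. (Natural numbers outside `1, …, g + l` are isolated
and play no role.) -/
def lollipop (g l : ℕ) : SimpleGraph ℕ :=
  SimpleGraph.fromRel fun i j => (1 ≤ i ∧ j = i + 1 ∧ j ≤ g + l) ∨ (i = 1 ∧ j = g)

/-- `v` labels vertices `v 1, …, v (g + l)` of `G` in such a way that `G` is obtained from the
lollipop `L_{g,l}` on these vertices (`g ≥ 3`, `l ≥ 1`) by attaching pendant vertices to some of
its nonpendant vertices `v 1, …, v (g + l - 1)`, and every vertex other than `v (g + l - 1)` is
adjacent to at most one pendant vertex. -/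
structure IsFLabelling (G : SimpleGraph V) (g l : ℕ) (v : ℕ → V) : Prop where
  three_le : 3 ≤ g
  one_le : 1 ≤ l
  injOn : Set.InjOn v (Set.Icc 1 (g + l))
  adj_iff : ∀ i ∈ Set.Icc 1 (g + l), ∀ j ∈ Set.Icc 1 (g + l),
    (G.Adj (v i) (v j) ↔ (lollipop g l).Adj i j)
  attached : ∀ u, u ∉ v '' Set.Icc 1 (g + l) →
    ∃ i ∈ Set.Icc 1 (g + l - 1), G.neighborSet u = {v i}
  atMostOne : ∀ w, w ≠ v (g + l - 1) → (G.pendantNeighborSet w).ncard ≤ 1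

/-- The nonbipartite unicyclic graphs of order `n` with domination number `γ` and girth `g`. -/
def nonbipartiteUnicyclic (n γ g : ℕ) : Set (SimpleGraph (Fin n)) :=
  {G | G.IsUnicyclic ∧ ¬ G.IsBipartite ∧ G.dominationNumber = γ ∧ G.girth = g}

end SimpleGraph

/-! The proof relocates branches. Let `x` be a unit eigenvector at a minimizer `G`, and `m` a
support vertex where `|x|` is largest among support vertices. Suppose a branch `B` hangs at `u`, the
signs of `x` alternate along it, and `|x u| ≤ |x m|`. Rehang `B` at `m`, raise `|x|` on `B` by `|x
m| - |x u|` and adjust a global sign: every edge term `(x a + x b) ^ 2` is unchanged and no entry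
shrinks. So the Rayleigh quotient does not grow, and the eigenvector equations exclude equality
(`IsSignPattern.qMin_relocate_lt`). A minimizer thus admits no such move within the class.

Connectedness, edge count, nonbipartiteness and girth survive relocation along bridges; the
domination number is the real constraint. It is preserved when one of two pendant vertices at `w`
moves to `m` (`dominationNumber_relocate_pendant`), and for a star by moving either its leaves or
the whole star (`IsStar.dominationNumber_relocate`). Hence every star is centred at `m`
(`eq_of_isStar`), and only `m` can have two pendant neighbours (`eq_of_two_le_ncard`).

Below each nonpendant tree vertex lies a star centre, so these vertices all lie on the path from the
cycle to `m`, which gives the labelling (`CycleForest.exists_isFLabelling`). That `x m ≠ 0` is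
`CycleForest.exists_isSupport_ne_zero`; since a zero at `v g` would propagate along the path to its
end, also `x (v g) ≠ 0`. -/

namespace SimpleGraph
open Matrix

/-! ### Quadratic form and least eigenvalue of the signless Laplacian -/

open Classical in
/-- Twice the quadratic form of the signless Laplacian, as a sum over ordered pairs. -/
noncomputable def qForm {V : Type*} [Fintype V] (G : SimpleGraph V) (x : V → ℝ) : ℝ :=
  ∑ a, ∑ b, if G.Adj a b then (x a + x b) ^ 2 else 0

theorem qForm_nonneg {V : Type*} [Fintype V] (G : SimpleGraph V) (x : V → ℝ) : 0 ≤ G.qForm x := by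
  unfold qForm
  refine Finset.sum_nonneg fun a _ => Finset.sum_nonneg fun b _ => ?_
  split_ifs <;> positivity

theorem add_eq_zero_of_qForm_eq_zero {V : Type*} [Fintype V] (G : SimpleGraph V) {x : V → ℝ} (h : G.qForm x = 0) {a b : V} (hab : G.Adj a b) :
    x a + x b = 0 := by
  classical
  have hn : ∀ a b, 0 ≤ if G.Adj a b then (x a + x b) ^ 2 else 0 := fun a b => by
    split_ifs <;> positivity
  rw [qForm, Finset.sum_eq_zero_iff_of_nonneg
    (fun a _ => Finset.sum_nonneg fun b _ => hn a b)] at h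
  have h1 := (Finset.sum_eq_zero_iff_of_nonneg (fun b _ => hn a b)).1 (h a (Finset.mem_univ a)) b
    (Finset.mem_univ b)
  rw [if_pos hab] at h1
  exact pow_eq_zero_iff (two_ne_zero) |>.1 h1

section Spectral

variable {V : Type*} [Fintype V] [DecidableEq V] (G : SimpleGraph V)

open Classical in
theorem signlessLapMatrix_mulVec_apply (x : V → ℝ) (v : V) :
    (G.signlessLapMatrix *ᵥ x) v = ∑ b, if G.Adj v b then x v + x b else 0 := by
  rw [signlessLapMatrix, add_mulVec, Pi.add_apply, degMatrix_mulVec_apply, adjMatrix_mulVec_apply,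
    degree_eq_sum_if_adj, Finset.sum_mul, neighborFinset_eq_filter, Finset.sum_filter,
    ← Finset.sum_add_distrib]
  refine Finset.sum_congr rfl fun b _ => ?_
  split_ifs <;> simp

theorem dotProduct_signlessLapMatrix_mulVec (x : V → ℝ) :
    x ⬝ᵥ (G.signlessLapMatrix *ᵥ x) = G.qForm x / 2 := by
  classical
  have h1 : x ⬝ᵥ (G.signlessLapMatrix *ᵥ x)
      = ∑ a, ∑ b, if G.Adj a b then x a * (x a + x b) else 0 := by
    simp only [dotProduct, signlessLapMatrix_mulVec_apply, Finset.mul_sum, mul_ite, mul_zero]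
  have h2 : x ⬝ᵥ (G.signlessLapMatrix *ᵥ x)
      = ∑ a, ∑ b, if G.Adj a b then x b * (x a + x b) else 0 := by
    rw [h1, Finset.sum_comm]
    refine Finset.sum_congr rfl fun a _ => Finset.sum_congr rfl fun b _ => ?_
    simp only [G.adj_comm b a, add_comm (x b)]
  have h3 : G.qForm x = x ⬝ᵥ (G.signlessLapMatrix *ᵥ x) + x ⬝ᵥ (G.signlessLapMatrix *ᵥ x) := by
    nth_rewrite 1 [h1]
    rw [h2, qForm, ← Finset.sum_add_distrib]
    refine Finset.sum_congr rfl fun a _ => ?_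
    rw [← Finset.sum_add_distrib]
    refine Finset.sum_congr rfl fun b _ => ?_
    split_ifs <;> ring
  linarith

theorem isHermitian_signlessLapMatrix : G.signlessLapMatrix.IsHermitian := by
  classical
  exact (G.isHermitian_degMatrix ℝ).add (G.isHermitian_adjMatrix ℝ)

theorem qMin_mem_spectrum [Nonempty V] : G.qMin ∈ spectrum ℝ G.signlessLapMatrix := by
  have h := G.isHermitian_signlessLapMatrix.spectrum_real_eq_range_eigenvalues
  rw [qMin, h]
  exact (Set.range_nonempty _).csInf_mem (Set.finite_range _)

/-- Subtracting the least eigenvalue leaves a nonnegative spectrum. Semidefiniteness is the Rayleigh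
bound, and vectors on which the form vanishes lie in the kernel, which settles the equality case. -/
theorem posSemidef_signlessLapMatrix_sub_qMin :
    (G.signlessLapMatrix - G.qMin • (1 : Matrix V V ℝ)).PosSemidef := by
  have hH := G.isHermitian_signlessLapMatrix
  refine posSemidef_iff_isHermitian_and_spectrum_nonneg.2 ⟨?_, ?_⟩
  · refine hH.sub ?_
    rw [IsHermitian, conjTranspose_smul, conjTranspose_one, star_trivial]
  · intro t ht
    have h1 : t + G.qMin ∈ spectrum ℝ G.signlessLapMatrix := by
      have := (spectrum.add_mem_add_iff (r := t) (s := G.qMin)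
        (a := G.signlessLapMatrix - G.qMin • (1 : Matrix V V ℝ))).2 ht
      rw [Algebra.algebraMap_eq_smul_one, add_comm] at this
      rw [add_comm]
      simpa [add_comm] using this
    have h2 : G.qMin ≤ t + G.qMin := by
      refine csInf_le ?_ h1
      rw [hH.spectrum_real_eq_range_eigenvalues]
      exact (Set.finite_range _).bddBelow
    show 0 ≤ t
    linarith

theorem dotProduct_sub_qMin_mulVec (x : V → ℝ) :
    star x ⬝ᵥ ((G.signlessLapMatrix - G.qMin • (1 : Matrix V V ℝ)) *ᵥ x)
      = G.qForm x / 2 - G.qMin * ∑ i, x i ^ 2 := by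
  rw [star_trivial, sub_mulVec, dotProduct_sub, dotProduct_signlessLapMatrix_mulVec, smul_mulVec,
    one_mulVec, dotProduct_smul, smul_eq_mul]
  simp only [dotProduct, pow_two]

theorem two_mul_qMin_mul_le_qForm (x : V → ℝ) : 2 * (G.qMin * ∑ i, x i ^ 2) ≤ G.qForm x := by
  have h := G.posSemidef_signlessLapMatrix_sub_qMin.dotProduct_mulVec_nonneg x
  rw [dotProduct_sub_qMin_mulVec] at h
  linarith

theorem mulVec_eq_of_qForm_le {x : V → ℝ} (h : G.qForm x ≤ 2 * (G.qMin * ∑ i, x i ^ 2)) :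
    G.signlessLapMatrix *ᵥ x = G.qMin • x := by
  have h1 := (G.posSemidef_signlessLapMatrix_sub_qMin.dotProduct_mulVec_zero_iff x).1 (by
    rw [dotProduct_sub_qMin_mulVec]
    linarith [G.two_mul_qMin_mul_le_qForm x])
  rw [sub_mulVec, smul_mulVec, one_mulVec] at h1
  exact sub_eq_zero.1 h1

theorem qForm_of_mulVec_eq {x : V → ℝ} (h : G.signlessLapMatrix *ᵥ x = G.qMin • x) :
    G.qForm x = 2 * (G.qMin * ∑ i, x i ^ 2) := by
  have h1 := G.dotProduct_signlessLapMatrix_mulVec x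
  rw [h, dotProduct_smul, smul_eq_mul] at h1
  have : x ⬝ᵥ x = ∑ i, x i ^ 2 := by simp only [dotProduct, pow_two]
  rw [this] at h1
  linarith

theorem exists_isUnitQMinEigenvector [Nonempty V] : ∃ x, G.IsUnitQMinEigenvector x := by
  have h := G.qMin_mem_spectrum
  rw [G.isHermitian_signlessLapMatrix.spectrum_real_eq_range_eigenvalues] at h
  obtain ⟨i, hi⟩ := h
  have hH := G.isHermitian_signlessLapMatrix
  refine ⟨hH.eigenvectorBasis i, ?_, ?_⟩
  · rw [hH.mulVec_eigenvectorBasis, hi]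
  · have := hH.eigenvectorBasis.orthonormal.1 i
    rw [EuclideanSpace.norm_eq, Real.sqrt_eq_one] at this
    simpa using this

variable {G} in
open Classical in
theorem sum_adj_of_mulVec_eq {x : V → ℝ} (hx : G.signlessLapMatrix *ᵥ x = G.qMin • x) (v : V) :
    (∑ b, if G.Adj v b then x v + x b else 0) = G.qMin * x v := by
  rw [← signlessLapMatrix_mulVec_apply, hx, Pi.smul_apply, smul_eq_mul]

/-- If the form vanishes at an eigenvector, its entries at adjacent vertices are opposite. By
connectedness `|x|` is then a nonzero constant, and the sign of `x` is a 2-colouring. -/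
theorem qMin_pos (hc : G.Connected) (hb : ¬ G.IsBipartite) : 0 < G.qMin := by
  have := hc.nonempty
  obtain ⟨x, hx⟩ := G.exists_isUnitQMinEigenvector
  have hE := G.qForm_of_mulVec_eq hx.1
  rw [hx.2] at hE
  by_contra hq
  have h0 : G.qForm x = 0 := le_antisymm (by linarith) (G.qForm_nonneg x)
  have hadj := fun a b (hab : G.Adj a b) => G.add_eq_zero_of_qForm_eq_zero h0 hab
  have habs : ∀ a b, |x a| = |x b| := fun a b => by
    refine (hc.preconnected a b).elim fun w => ?_
    induction w with
    | nil => rfl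
    | cons h p ih =>
      rw [← ih, eq_neg_of_add_eq_zero_left (hadj _ _ h), abs_neg]
  have hne : ∀ a, x a ≠ 0 := by
    intro a ha
    have hz : ∀ b, x b = 0 := fun b => by
      rw [← abs_eq_zero, habs b a, ha, abs_zero]
    have := hx.2
    simp [hz] at this
  apply hb
  refine ⟨Coloring.mk (fun v => if 0 < x v then 0 else 1) ?_⟩
  intro a b hab
  have h1 := hadj a b hab
  have h2 := hne a
  have h3 := hne b
  rcases lt_or_gt_of_ne h2 with h | h
  · rw [if_neg (by linarith), if_pos (by linarith)]
    decide
  · rw [if_pos (by linarith), if_neg (by linarith)]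
    decide

end Spectral

end SimpleGraph

/-! ### Relocating a branch: edge count, connectedness, bipartiteness, girth -/

namespace SimpleGraph
open Matrix

/-- The only edges leaving `B` end in the vertex `u` outside `B`. -/
structure IsAttached {V : Type*} (G : SimpleGraph V) (B : Set V) (u : V) : Prop where
  notMem : u ∉ B
  eq_of_adj : ∀ a ∈ B, ∀ b, b ∉ B → G.Adj a b → b = u

/-- The graph obtained from `G` by replacing each edge between `B` and `u` by an edge
to `m`. -/
def relocate {V : Type*} (G : SimpleGraph V) (B : Set V) (u m : V) : SimpleGraph V where
  Adj a b := ((a ∈ B ↔ b ∈ B) ∧ G.Adj a b) ∨ (a ∈ B ∧ b ∉ B ∧ b = m ∧ G.Adj a u) ∨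
    (b ∈ B ∧ a ∉ B ∧ a = m ∧ G.Adj b u)
  symm := ⟨fun a b h => by
    rcases h with h | h | h
    · exact Or.inl ⟨h.1.symm, h.2.symm⟩
    · exact Or.inr (Or.inr h)
    · exact Or.inr (Or.inl h)⟩
  loopless := ⟨fun a h => by
    rcases h with h | h | h
    · exact G.irrefl h.2
    · exact h.2.1 h.1
    · exact h.2.1 h.1⟩

section Relocate

variable {V : Type*} {G : SimpleGraph V} {B : Set V} {u m : V}

theorem relocate_adj_of_mem {a b : V} (ha : a ∈ B) (hb : b ∈ B) :
    (G.relocate B u m).Adj a b ↔ G.Adj a b := by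
  simp [relocate, ha, hb]

theorem relocate_adj_of_notMem {a b : V} (ha : a ∉ B) (hb : b ∉ B) :
    (G.relocate B u m).Adj a b ↔ G.Adj a b := by
  simp [relocate, ha, hb]

theorem relocate_adj_of_mem_of_notMem {a b : V} (ha : a ∈ B) (hb : b ∉ B) :
    (G.relocate B u m).Adj a b ↔ b = m ∧ G.Adj a u := by
  simp [relocate, ha, hb]

theorem IsAttached.adj_iff (h : G.IsAttached B u) {a b : V} (ha : a ∈ B) (hb : b ∉ B) :
    G.Adj a b ↔ b = u ∧ G.Adj a u :=
  ⟨fun hab => by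
    have := h.eq_of_adj a ha b hb hab
    exact ⟨this, this ▸ hab⟩, fun hab => hab.1 ▸ hab.2⟩

theorem IsAttached.relocate (_h : G.IsAttached B u) (hm : m ∉ B) :
    (G.relocate B u m).IsAttached B m :=
  ⟨hm, fun _ ha _ hb hab => ((relocate_adj_of_mem_of_notMem ha hb).1 hab).1⟩

/-- The move is invertible, so an inequality proved for all moves becomes an equality; girth and
domination number are treated this way. -/
theorem IsAttached.relocate_relocate (h : G.IsAttached B u) (hm : m ∉ B) :
    (G.relocate B u m).relocate B m u = G := by
  ext a b
  by_cases ha : a ∈ B <;> by_cases hb : b ∈ B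
  · rw [relocate_adj_of_mem ha hb, relocate_adj_of_mem ha hb]
  · rw [relocate_adj_of_mem_of_notMem ha hb, relocate_adj_of_mem_of_notMem ha hm, h.adj_iff ha hb]
    simp
  · rw [adj_comm, relocate_adj_of_mem_of_notMem hb ha, relocate_adj_of_mem_of_notMem hb hm,
      G.adj_comm a b, h.adj_iff hb ha]
    simp
  · rw [relocate_adj_of_notMem ha hb, relocate_adj_of_notMem ha hb]

-- Relocation is a bijection on ordered adjacent pairs. With constant summands this counts edges;
-- with squares it compares quadratic forms.
open Classical in
theorem IsAttached.sum_relocate [Fintype V] {α : Type*} [AddCommMonoid α] (h : G.IsAttached B u)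
    (hm : m ∉ B) {F F' : V → V → α}
    (hin : ∀ a b, a ∈ B → b ∈ B → G.Adj a b → F' a b = F a b)
    (hout : ∀ a b, a ∉ B → b ∉ B → G.Adj a b → F' a b = F a b)
    (h1 : ∀ a ∈ B, G.Adj a u → F' a m = F a u) (h2 : ∀ a ∈ B, G.Adj a u → F' m a = F u a) :
    (∑ a, ∑ b, if (G.relocate B u m).Adj a b then F' a b else 0)
      = ∑ a, ∑ b, if G.Adj a b then F a b else 0 := by
  have hu := h.notMem
  rw [← Fintype.sum_prod_type', ← Fintype.sum_prod_type', ← Finset.sum_filter, ← Finset.sum_filter]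
  refine Finset.sum_nbij'
    (fun p => if p.1 ∈ B ∧ p.2 ∉ B then (p.1, u) else if p.1 ∉ B ∧ p.2 ∈ B then (u, p.2) else p)
    (fun p => if p.1 ∈ B ∧ p.2 ∉ B then (p.1, m) else if p.1 ∉ B ∧ p.2 ∈ B then (m, p.2) else p)
    ?_ ?_ ?_ ?_ ?_
  all_goals
    rintro ⟨a, b⟩ hp
    simp only [Finset.mem_filter, Finset.mem_univ, true_and] at hp
    by_cases ha : a ∈ B <;> by_cases hb : b ∈ B
    all_goals
      first
      | rw [relocate_adj_of_mem ha hb] at hp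
      | rw [relocate_adj_of_mem_of_notMem ha hb] at hp
      | rw [adj_comm, relocate_adj_of_mem_of_notMem hb ha] at hp
      | rw [relocate_adj_of_notMem ha hb] at hp
      | rw [h.adj_iff ha hb] at hp
      | rw [adj_comm, h.adj_iff hb ha] at hp
      | skip
  all_goals
    simp_all [relocate_adj_of_mem, relocate_adj_of_notMem, adj_comm]
  · exact (relocate_adj_of_mem_of_notMem ‹_› hm).2 ⟨rfl, hp.2.symm⟩ |>.symm
  · exact ((relocate_adj_of_mem_of_notMem hb hm).2 ⟨rfl, hp.2.symm⟩).symm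

theorem two_mul_ncard_edgeSet [Fintype V] (G : SimpleGraph V) [DecidableRel G.Adj] :
    2 * G.edgeSet.ncard = ∑ a, ∑ b, if G.Adj a b then 1 else 0 := by
  classical
  rw [← coe_edgeFinset, Set.ncard_coe_finset, ← sum_degrees_eq_twice_card_edges]
  exact Finset.sum_congr rfl fun a _ => G.degree_eq_sum_if_adj a

theorem IsAttached.ncard_edgeSet_relocate [Fintype V] (h : G.IsAttached B u) (hm : m ∉ B) :
    (G.relocate B u m).edgeSet.ncard = G.edgeSet.ncard := by
  classical
  refine Nat.eq_of_mul_eq_mul_left two_pos ?_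
  rw [two_mul_ncard_edgeSet, two_mul_ncard_edgeSet]
  exact h.sum_relocate hm (fun _ _ _ _ _ => rfl) (fun _ _ _ _ _ => rfl) (fun _ _ _ => rfl)
    fun _ _ _ => rfl

theorem Reachable.of_adj_map {W : Type*} {H : SimpleGraph W} {f : V → W}
    (hf : ∀ a b, G.Adj a b → H.Reachable (f a) (f b)) {a b : V} (hab : G.Reachable a b) :
    H.Reachable (f a) (f b) :=
  hab.elim fun w => by
    induction w with
    | nil => rfl
    | cons h p ih => exact (hf _ _ h).trans (ih ⟨p⟩)

theorem IsAttached.connected_relocate (h : G.IsAttached B u) (hm : m ∉ B) (hc : G.Connected) :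
    (G.relocate B u m).Connected := by
  classical
  have hu := h.notMem
  have h1 : ∀ a, a ∉ B → (G.relocate B u m).Reachable a m := by
    intro a ha
    -- Collapsing `B` to `u` sends each edge of `G` to an edge outside `B` or to a point.
    have := Reachable.of_adj_map (f := fun v => if v ∈ B then u else v)
      (H := G.relocate B u m) ?_ (hc.preconnected a m)
    · simpa [ha, hm] using this
    · intro a b hab
      by_cases ha : a ∈ B <;> by_cases hb : b ∈ B
      · simp [ha, hb]
      · simp [ha, h.eq_of_adj a ha b hb hab]
      · simp [hb, h.eq_of_adj b hb a ha hab.symm]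
      · simp only [ha, hb, if_false]
        exact ((relocate_adj_of_notMem ha hb).2 hab).reachable
  have h2 : ∀ a, a ∈ B → (G.relocate B u m).Reachable a m := by
    intro a ha
    -- Dually, the complement of `B` is collapsed to `m`.
    have := Reachable.of_adj_map (f := fun v => if v ∈ B then v else m)
      (H := G.relocate B u m) ?_ (hc.preconnected a u)
    · simpa [ha, hu] using this
    · intro a b hab
      by_cases ha : a ∈ B <;> by_cases hb : b ∈ B
      · simp only [ha, hb, if_true]
        exact ((relocate_adj_of_mem ha hb).2 hab).reachable
      · simp only [ha, hb, if_true, if_false]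
        exact ((relocate_adj_of_mem_of_notMem ha hm).2
          ⟨rfl, ((h.adj_iff ha hb).1 hab).2⟩).reachable
      · simp only [ha, hb, if_true, if_false]
        exact ((relocate_adj_of_mem_of_notMem hb hm).2
          ⟨rfl, ((h.adj_iff hb ha).1 hab.symm).2⟩).symm.reachable
      · simp [ha, hb]
  have h3 : ∀ a, (G.relocate B u m).Reachable a m := fun a => by
    by_cases ha : a ∈ B
    exacts [h2 a ha, h1 a ha]
  exact (connected_iff_exists_forall_reachable _).2 ⟨m, fun a => (h3 a).symm⟩

theorem IsAttached.not_isBipartite_relocate (h : G.IsAttached B u) (hm : m ∉ B)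
    (hb : ¬ G.IsBipartite) : ¬ (G.relocate B u m).IsBipartite := by
  classical
  rintro ⟨C⟩
  apply hb
  have hu := h.notMem
  have hmu : ∀ a ∈ B, G.Adj a u → C a ≠ C m := fun a ha hau =>
    C.valid ((relocate_adj_of_mem_of_notMem ha hm).2 ⟨rfl, hau⟩)
  have aux : ∀ x y z : Fin 2, x ≠ z → x + (y - z) ≠ y := by decide
  -- Shifting the colours on `B` by `C u - C m` turns a proper edge into `m` into a proper edge into
  -- `u`.
  refine ⟨Coloring.mk (fun v => if v ∈ B then C v + (C u - C m) else C v) ?_⟩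
  intro a b hab
  by_cases ha : a ∈ B <;> by_cases hb : b ∈ B
  · simpa [ha, hb] using C.valid ((relocate_adj_of_mem ha hb).2 hab)
  · obtain ⟨rfl, hau⟩ := (h.adj_iff ha hb).1 hab
    simp only [ha, hb, if_true, if_false]
    exact aux _ _ _ (hmu a ha hau)
  · obtain ⟨rfl, hau⟩ := (h.adj_iff hb ha).1 hab.symm
    simp only [ha, hb, if_true, if_false]
    exact (aux _ _ _ (hmu b hb hau)).symm
  · simpa [ha, hb] using C.valid ((relocate_adj_of_notMem ha hb).2 hab)

/-- Each edge between `B` and `u` is a bridge, cut off by a part of `B`. -/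
def BridgesAt (G : SimpleGraph V) (B : Set V) (u : V) : Prop :=
  ∀ a ∈ B, G.Adj a u → ∃ C ⊆ B, a ∈ C ∧ ∀ b ∈ C, ∀ c, c ∉ C → G.Adj b c → b = a ∧ c = u

/-- Without the edge `au` no walk can leave `C`. -/
theorem isBridge_of_forall {a u : V} {C : Set V} (ha : a ∈ C) (hu : u ∉ C)
    (h : ∀ b ∈ C, ∀ c, c ∉ C → G.Adj b c → b = a ∧ c = u) : G.IsBridge s(a, u) := by
  rw [isBridge_iff]
  have key : ∀ {v w}, (G.deleteEdges {s(a, u)}).Walk v w → v ∈ C → w ∈ C := by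
    intro v w p
    induction p with
    | nil => exact id
    | cons hvw _ ih =>
      intro hv
      refine ih ?_
      by_contra hw
      rw [deleteEdges_adj] at hvw
      obtain ⟨rfl, rfl⟩ := h _ hv _ hw hvw.1
      exact hvw.2 rfl
  rintro ⟨p⟩
  exact hu (key p ha)

theorem IsAttached.bridgesAt_relocate (h : G.IsAttached B u) (hm : m ∉ B) (hB : G.BridgesAt B u) :
    (G.relocate B u m).BridgesAt B m := by
  intro a ha ham
  obtain ⟨C, hCB, haC, hC⟩ := hB a ha ((relocate_adj_of_mem_of_notMem ha hm).1 ham).2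
  have huC : u ∉ C := fun hu => h.notMem (hCB hu)
  refine ⟨C, hCB, haC, fun b hb c hc hbc => ?_⟩
  by_cases hcB : c ∈ B
  · have := hC b hb c hc ((relocate_adj_of_mem (hCB hb) hcB).1 hbc)
    exact absurd (this.2 ▸ hcB) h.notMem
  · have h1 := (relocate_adj_of_mem_of_notMem (hCB hb) hcB).1 hbc
    exact ⟨(hC b hb u huC h1.2).1, h1.1⟩

/-- A cycle uses no bridge, hence none of the edges that are moved. -/
theorem IsAttached.exists_cycle_relocate (h : G.IsAttached B u)
    (hB : G.BridgesAt B u) {a : V} {w : G.Walk a a} (hw : w.IsCycle) :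
    ∃ w' : (G.relocate B u m).Walk a a, w'.IsCycle ∧ w'.length = w.length := by
  have key : ∀ a b, s(a, b) ∈ w.edges → a ∈ B → b ∉ B → False := by
    intro a b hab ha hb
    obtain ⟨rfl, hau⟩ := (h.adj_iff ha hb).1 (w.adj_of_mem_edges hab)
    obtain ⟨C, hCB, haC, hC⟩ := hB a ha hau
    exact (isBridge_iff_forall_cycle_notMem (w.adj_of_mem_edges hab)).1
      (isBridge_of_forall haC (fun hu => hb (hCB hu)) hC) w hw hab
  have hmem : ∀ e ∈ w.edges, e ∈ (G.relocate B u m).edgeSet := by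
    intro e he
    induction e using Sym2.ind with
    | _ a b =>
    have hab := w.adj_of_mem_edges he
    by_cases ha : a ∈ B <;> by_cases hb : b ∈ B
    · exact (relocate_adj_of_mem ha hb).2 hab
    · exact (key a b he ha hb).elim
    · exact (key b a (Sym2.eq_swap ▸ he) hb ha).elim
    · exact (relocate_adj_of_notMem ha hb).2 hab
  exact ⟨w.transfer _ hmem, hw.transfer hmem, w.length_transfer hmem⟩

theorem IsAttached.girth_relocate (h : G.IsAttached B u) (hm : m ∉ B) (hB : G.BridgesAt B u) :
    (G.relocate B u m).girth = G.girth := by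
  have aux : ∀ {H : SimpleGraph V} {u m : V}, H.IsAttached B u → H.BridgesAt B u →
      (H.relocate B u m).egirth ≤ H.egirth := by
    intro H u m h hB
    refine le_egirth.2 fun a w hw => ?_
    obtain ⟨w', hw', hl⟩ := h.exists_cycle_relocate (m := m) hB hw
    exact hl ▸ egirth_le_length hw'
  have h1 : (G.relocate B u m).egirth = G.egirth := by
    refine le_antisymm (aux h hB) ?_
    have := aux (u := m) (m := u) (h.relocate hm) (h.bridgesAt_relocate hm hB)
    rwa [h.relocate_relocate hm] at this
  rw [girth, girth, h1]

theorem IsAttached.relocate_mem_nonbipartiteUnicyclic {n γ g : ℕ} {G : SimpleGraph (Fin n)}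
    {B : Set (Fin n)} {u m : Fin n} (h : G.IsAttached B u) (hm : m ∉ B) (hB : G.BridgesAt B u)
    (hG : G ∈ nonbipartiteUnicyclic n γ g) (hγ : (G.relocate B u m).dominationNumber = γ) :
    G.relocate B u m ∈ nonbipartiteUnicyclic n γ g :=
  ⟨⟨h.connected_relocate hm hG.1.1, (h.ncard_edgeSet_relocate hm).trans hG.1.2⟩,
    h.not_isBipartite_relocate hm hG.2.1, hγ, (h.girth_relocate hm hB).trans hG.2.2.2⟩

end Relocate
end SimpleGraph

/-! ### Domination number under relocation -/

namespace SimpleGraph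

section Domination

variable {V : Type*} {G : SimpleGraph V} {B : Set V} {u m : V}

theorem IsDominatingSet.dominationNumber_le {D : Finset V} (h : G.IsDominatingSet D) :
    G.dominationNumber ≤ D.card :=
  Nat.sInf_le ⟨D, h, rfl⟩

theorem exists_isDominatingSet_card_eq [Fintype V] (G : SimpleGraph V) :
    ∃ D : Finset V, G.IsDominatingSet D ∧ D.card = G.dominationNumber :=
  Nat.sInf_mem (s := {k | ∃ D : Finset V, G.IsDominatingSet D ∧ D.card = k})
    ⟨_, Finset.univ, fun v hv => absurd (Finset.mem_univ v) hv, rfl⟩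

theorem IsDominatingSet.mono {D D' : Finset V} (h : G.IsDominatingSet D) (hD : D ⊆ D') :
    G.IsDominatingSet D' := fun v hv =>
  let ⟨z, hz, hvz⟩ := h v fun hv' => hv (hD hv')
  ⟨z, hD hz, hvz⟩

theorem IsDominatingSet.erase [DecidableEq V] {D : Finset V} (h : G.IsDominatingSet D) {p w : V}
    (hp : G.neighborSet p = {w}) (hw : w ∈ D) : G.IsDominatingSet (D.erase p) := by
  have hadj : ∀ z, G.Adj p z ↔ z = w := fun z => by
    rw [← mem_neighborSet, hp, Set.mem_singleton_iff]
  have hpw : p ≠ w := ((hadj w).2 rfl).ne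
  intro v hv
  by_cases hvp : v = p
  · subst hvp
    exact ⟨w, Finset.mem_erase.2 ⟨hpw.symm, hw⟩, (hadj w).2 rfl⟩
  · have hvD : v ∉ D := fun h' => hv (Finset.mem_erase.2 ⟨hvp, h'⟩)
    obtain ⟨z, hz, hvz⟩ := h v hvD
    refine ⟨z, Finset.mem_erase.2 ⟨?_, hz⟩, hvz⟩
    rintro rfl
    exact hvD ((hadj v).1 hvz.symm ▸ hw)

/-- A pendant vertex in `D` can be exchanged for its neighbour, which dominates at least as much. -/
theorem IsDominatingSet.exists_mem_support {D : Finset V} (h : G.IsDominatingSet D) {p w : V}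
    (hp : G.neighborSet p = {w}) :
    ∃ D' : Finset V, G.IsDominatingSet D' ∧ D'.card ≤ D.card ∧ w ∈ D' ∧ ∀ v ∈ D, v ≠ p → v ∈ D' := by
  classical
  by_cases hpD : p ∈ D
  · refine ⟨(insert w D).erase p, (h.mono (Finset.subset_insert _ _)).erase hp
      (Finset.mem_insert_self _ _), ?_, ?_, ?_⟩
    · rw [Finset.card_erase_of_mem (Finset.mem_insert_of_mem hpD)]
      exact Nat.sub_le_iff_le_add.2 (Finset.card_insert_le _ _)
    · refine Finset.mem_erase.2 ⟨?_, Finset.mem_insert_self _ _⟩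
      rintro rfl
      have : w ∈ G.neighborSet w := by rw [hp]; rfl
      exact G.irrefl this
    · exact fun v hv hvp => Finset.mem_erase.2 ⟨hvp, Finset.mem_insert_of_mem hv⟩
  · obtain ⟨z, hz, hpz⟩ := h p hpD
    have : z = w := by
      rw [← mem_neighborSet, hp] at hpz
      exact hpz
    exact ⟨D, h, le_rfl, this ▸ hz, fun v hv _ => hv⟩

/-- The condition `w ≠ p'` keeps the second exchange from discarding `w`. -/
theorem IsDominatingSet.exists_mem_supports {D : Finset V} (h : G.IsDominatingSet D)
    {p w p' w' : V} (hp : G.neighborSet p = {w}) (hp' : G.neighborSet p' = {w'}) (hne : w ≠ p') :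
    ∃ D' : Finset V, G.IsDominatingSet D' ∧ D'.card ≤ D.card ∧ w ∈ D' ∧ w' ∈ D' := by
  obtain ⟨D₁, h₁, hc₁, hw₁, -⟩ := h.exists_mem_support hp
  obtain ⟨D₂, h₂, hc₂, hw₂, hD⟩ := h₁.exists_mem_support hp'
  exact ⟨D₂, h₂, hc₂.trans hc₁, hD w hw₁ hne, hw₂⟩

theorem IsDominatingSet.relocate_of_mem {D : Finset V} (h : G.IsDominatingSet D)
    (hB : G.IsAttached B u) (hmB : m ∉ B) (hu : u ∈ D) (hm : m ∈ D) :
    (G.relocate B u m).IsDominatingSet D := by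
  intro v hv
  obtain ⟨z, hz, hvz⟩ := h v hv
  by_cases hvB : v ∈ B <;> by_cases hzB : z ∈ B
  · exact ⟨z, hz, (relocate_adj_of_mem hvB hzB).2 hvz⟩
  · exact ⟨m, hm, (relocate_adj_of_mem_of_notMem hvB hmB).2 ⟨rfl, ((hB.adj_iff hvB hzB).1 hvz).2⟩⟩
  · exact absurd (hB.eq_of_adj z hzB v hvB hvz.symm ▸ hu) hv
  · exact ⟨z, hz, (relocate_adj_of_notMem hvB hzB).2 hvz⟩

/-- Both ends of every moved edge already lie in `D`, so these edges dominate nothing that needs it.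
-/
theorem IsDominatingSet.relocate_of_adj_mem {D : Finset V} (h : G.IsDominatingSet D)
    (hB : G.IsAttached B u) (hu : u ∈ D) (hr : ∀ a ∈ B, G.Adj a u → a ∈ D) :
    (G.relocate B u m).IsDominatingSet D := by
  intro v hv
  obtain ⟨z, hz, hvz⟩ := h v hv
  by_cases hvB : v ∈ B <;> by_cases hzB : z ∈ B
  · exact ⟨z, hz, (relocate_adj_of_mem hvB hzB).2 hvz⟩
  · exact absurd (hr v hvB ((hB.adj_iff hvB hzB).1 hvz).2) hv
  · exact absurd (hB.eq_of_adj z hzB v hvB hvz.symm ▸ hu) hv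
  · exact ⟨z, hz, (relocate_adj_of_notMem hvB hzB).2 hvz⟩

theorem relocate_neighborSet_of_notMem {p : V} (hp : p ∉ B) (hpm : p ≠ m)
    (h : ∀ z ∈ B, ¬ G.Adj p z) : (G.relocate B u m).neighborSet p = G.neighborSet p := by
  ext z
  rw [mem_neighborSet, mem_neighborSet]
  by_cases hz : z ∈ B
  · rw [adj_comm, relocate_adj_of_mem_of_notMem hz hp]
    simp [hpm, h z hz]
  · exact relocate_adj_of_notMem hp hz

theorem adj_iff_of_neighborSet_eq {p w : V} (h : G.neighborSet p = {w}) (z : V) :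
    G.Adj p z ↔ z = w := by
  rw [← mem_neighborSet, h, Set.mem_singleton_iff]

theorem isAttached_singleton {p w : V} (hp : G.neighborSet p = {w}) : G.IsAttached {p} w := by
  have hadj := adj_iff_of_neighborSet_eq hp
  refine ⟨fun h => ((hadj w).2 rfl).ne (Set.mem_singleton_iff.1 h).symm, ?_⟩
  rintro a rfl b _ hab
  exact (hadj b).1 hab

theorem dominationNumber_relocate_pendant_le [Fintype V] {p p' t w : V}
    (hp : G.neighborSet p = {w}) (hp' : G.neighborSet p' = {w}) (ht : G.neighborSet t = {m})
    (hmp : m ≠ p) (hwt : w ≠ t) :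
    (G.relocate {p} w m).dominationNumber ≤ G.dominationNumber := by
  obtain ⟨D, hD, hc⟩ := G.exists_isDominatingSet_card_eq
  obtain ⟨D', hD', hc', hw, hm⟩ := hD.exists_mem_supports hp' ht hwt
  exact (hD'.relocate_of_mem (isAttached_singleton hp) hmp hw hm).dominationNumber_le.trans
    (hc'.trans hc.le)

/-- Moving a pendant vertex between two support vertices, the first of which keeps a pendant
vertex, does not change the domination number. -/
theorem dominationNumber_relocate_pendant [Fintype V] {p p' t w : V}
    (hp : G.neighborSet p = {w}) (hp' : G.neighborSet p' = {w}) (ht : G.neighborSet t = {m})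
    (hpp' : p ≠ p') (hwm : w ≠ m) (hmp : m ≠ p) (hmp' : m ≠ p') (hwt : w ≠ t) :
    (G.relocate {p} w m).dominationNumber = G.dominationNumber := by
  refine le_antisymm (dominationNumber_relocate_pendant_le hp hp' ht hmp hwt) ?_
  have hB := isAttached_singleton hp
  have hwp : w ≠ p := hB.notMem
  have htp : t ≠ p := by
    rintro rfl
    exact hwm (Set.singleton_injective (hp.symm.trans ht))
  have htm : t ≠ m := ((adj_iff_of_neighborSet_eq ht m).2 rfl).ne
  have h1 : (G.relocate {p} w m).neighborSet p = {m} := by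
    ext z
    rw [mem_neighborSet, Set.mem_singleton_iff]
    by_cases hz : z = p
    · subst hz
      simp [hmp.symm]
    · rw [relocate_adj_of_mem_of_notMem (Set.mem_singleton p) hz]
      simp [adj_iff_of_neighborSet_eq hp]
  have h2 : (G.relocate {p} w m).neighborSet p' = {w} := by
    rw [relocate_neighborSet_of_notMem (Set.mem_singleton_iff.not.2 hpp'.symm) hmp'.symm, hp']
    rintro z rfl h
    exact hwp ((adj_iff_of_neighborSet_eq hp' _).1 h).symm
  have h3 : (G.relocate {p} w m).neighborSet t = {m} := by
    rw [relocate_neighborSet_of_notMem (Set.mem_singleton_iff.not.2 htp) htm, ht]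
    rintro z rfl h
    exact hmp ((adj_iff_of_neighborSet_eq ht _).1 h).symm
  -- The inverse move has the same shape: `p` and `t` are now both pendant at `m`, and `p'` is
  -- pendant at `w`.
  have := dominationNumber_relocate_pendant_le h1 h3 h2 hwp hmp'
  rwa [hB.relocate_relocate hmp] at this

/-- A star: the neighbours of `r` other than `u` are the elements of `L`, they are pendant, and
there is at least one. -/
structure IsStar (G : SimpleGraph V) (r u : V) (L : Set V) : Prop where
  adj : G.Adj r u
  mem_iff : ∀ v, v ∈ L ↔ G.Adj r v ∧ v ≠ u
  neighborSet_eq : ∀ v ∈ L, G.neighborSet v = {r}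
  nonempty : L.Nonempty

namespace IsStar

variable {r : V} {L : Set V}

theorem notMem (h : G.IsStar r u L) : r ∉ L := fun hr => G.irrefl ((h.mem_iff r).1 hr).1

theorem notMem_right (h : G.IsStar r u L) : u ∉ L := fun hu => ((h.mem_iff u).1 hu).2 rfl

theorem adj_iff (h : G.IsStar r u L) {v : V} (hv : v ∈ L) (z : V) : G.Adj v z ↔ z = r :=
  adj_iff_of_neighborSet_eq (h.neighborSet_eq v hv) z

theorem isAttached_leaves (h : G.IsStar r u L) : G.IsAttached L r :=
  ⟨h.notMem, fun _ ha _ _ hab => (h.adj_iff ha _).1 hab⟩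

theorem isAttached_star (h : G.IsStar r u L) : G.IsAttached (insert r L) u := by
  refine ⟨fun hu => ?_, ?_⟩
  · rcases hu with rfl | hu
    · exact G.irrefl h.adj
    · exact h.notMem_right hu
  · rintro a (rfl | ha) b hb hab
    · by_contra hbu
      exact hb (Or.inr ((h.mem_iff b).2 ⟨hab, hbu⟩))
    · exact absurd (Or.inl ((h.adj_iff ha b).1 hab)) hb

theorem eq_of_mem_of_adj (h : G.IsStar r u L) {a : V} (ha : a ∈ insert r L) (hau : G.Adj a u) :
    a = r := by
  rcases ha with rfl | ha
  · rfl
  · exact absurd ((h.adj_iff ha u).1 hau) h.adj.ne'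

theorem bridgesAt_leaves (h : G.IsStar r u L) : G.BridgesAt L r := by
  intro a ha _
  refine ⟨{a}, Set.singleton_subset_iff.2 ha, rfl, ?_⟩
  rintro b rfl c _ hbc
  exact ⟨rfl, (h.adj_iff ha c).1 hbc⟩

theorem bridgesAt_star (h : G.IsStar r u L) : G.BridgesAt (insert r L) u := by
  intro a ha hau
  refine ⟨insert r L, subset_rfl, ha, fun b hb c hc hbc => ?_⟩
  obtain ⟨rfl, hbu⟩ := (h.isAttached_star.adj_iff hb hc).1 hbc
  exact ⟨(h.eq_of_mem_of_adj hb hbu).trans (h.eq_of_mem_of_adj ha hau).symm, rfl⟩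

/-- One of two ways of enlarging the set of vertices attached at a support vertex `m`, at the
expense of a star elsewhere, preserves the domination number. -/
theorem dominationNumber_relocate [Fintype V] (h : G.IsStar r u L) {t : V}
    (ht : G.neighborSet t = {m}) (hmr : m ≠ r) (hmu : m ≠ u) (hmL : m ∉ L) :
    (G.relocate L r m).dominationNumber = G.dominationNumber ∨
      (G.relocate (insert r L) u m).dominationNumber = G.dominationNumber := by
  classical
  obtain ⟨l, hl⟩ := h.nonempty
  have hlr := h.neighborSet_eq l hl
  have hadjt := adj_iff_of_neighborSet_eq ht
  have htm : t ≠ m := ((hadjt m).2 rfl).ne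
  have htL : t ∉ L := fun h' =>
    hmr (Set.singleton_injective (ht.symm.trans (h.neighborSet_eq t h')))
  have hrt : r ≠ t := by
    rintro rfl
    exact hmu ((hadjt u).1 h.adj).symm
  have hut : u ≠ t := by
    rintro rfl
    exact hmr ((hadjt r).1 h.adj.symm).symm
  have hur : u ≠ r := h.adj.ne'
  have hmB : m ∉ insert r L := fun h' => h'.elim hmr hmL
  have hr₁ : (G.relocate L r m).neighborSet r = {u} := by
    ext z
    rw [mem_neighborSet, Set.mem_singleton_iff]
    by_cases hz : z ∈ L
    · rw [adj_comm, relocate_adj_of_mem_of_notMem hz h.notMem]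
      exact ⟨fun h' => absurd h'.1.symm hmr, fun h' => absurd (h' ▸ hz) h.notMem_right⟩
    · rw [relocate_adj_of_notMem h.notMem hz]
      refine ⟨fun h' => ?_, fun h' => h' ▸ h.adj⟩
      by_contra hzu
      exact hz ((h.mem_iff z).2 ⟨h', hzu⟩)
  have ht₁ : (G.relocate L r m).neighborSet t = {m} := by
    rw [relocate_neighborSet_of_notMem htL htm, ht]
    exact fun z hz h' => hmL ((hadjt z).1 h' ▸ hz)
  -- After its leaves leave, `r` is pendant at `u`; in a dominating set containing `r` and `m` it
  -- can be replaced by `u`.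
  have hle₁ : (G.relocate L r m).dominationNumber ≤ G.dominationNumber := by
    obtain ⟨D, hD, hc⟩ := G.exists_isDominatingSet_card_eq
    obtain ⟨D', hD', hc', hr, hm⟩ := hD.exists_mem_supports hlr ht hrt
    have h1 : (G.relocate L r m).IsDominatingSet ((insert u D').erase r) :=
      ((hD'.mono (Finset.subset_insert _ _)).relocate_of_mem h.isAttached_leaves hmL
        (Finset.mem_insert_of_mem hr) (Finset.mem_insert_of_mem hm)).erase hr₁
        (Finset.mem_insert_self _ _)
    refine h1.dominationNumber_le.trans ?_
    rw [Finset.card_erase_of_mem (Finset.mem_insert_of_mem hr)]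
    have := Finset.card_insert_le u D'
    omega
  rcases hle₁.eq_or_lt with heq | hlt
  · exact Or.inl heq
  right
  have hl₂ : (G.relocate (insert r L) u m).neighborSet l = {r} := by
    ext z
    rw [mem_neighborSet, Set.mem_singleton_iff]
    by_cases hz : z ∈ insert r L
    · rw [relocate_adj_of_mem (Set.mem_insert_of_mem _ hl) hz, h.adj_iff hl]
    · rw [relocate_adj_of_mem_of_notMem (Set.mem_insert_of_mem _ hl) hz, h.adj_iff hl]
      exact ⟨fun h' => absurd h'.2 hur, fun h' => absurd (Or.inl h') hz⟩
  have ht₂ : (G.relocate (insert r L) u m).neighborSet t = {m} := by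
    rw [relocate_neighborSet_of_notMem (fun h' => h'.elim hrt.symm htL) htm, ht]
    exact fun z hz h' => hmB ((hadjt z).1 h' ▸ hz)
  refine le_antisymm ?_ ?_
  -- Strict inequality leaves room for one vertex. A minimum set after moving the leaves can be
  -- taken to contain `u` and `m`; adding `r` makes it dominate `G`, and it still does when the star
  -- moves because it contains `r` and `u`.
  · obtain ⟨D, hD, hc⟩ := (G.relocate L r m).exists_isDominatingSet_card_eq
    obtain ⟨D', hD', hc', hu, hm⟩ := hD.exists_mem_supports hr₁ ht₁ hut
    have h1 := (hD'.mono (Finset.subset_insert r D')).relocate_of_mem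
      (h.isAttached_leaves.relocate hmL) h.notMem (Finset.mem_insert_of_mem hm)
      (Finset.mem_insert_self _ _)
    rw [h.isAttached_leaves.relocate_relocate hmL] at h1
    have h2 := h1.relocate_of_adj_mem (m := m) h.isAttached_star (Finset.mem_insert_of_mem hu)
      fun a ha hau => h.eq_of_mem_of_adj ha hau ▸ Finset.mem_insert_self _ _
    have := h2.dominationNumber_le
    have := Finset.card_insert_le r D'
    omega
  · obtain ⟨D, hD, hc⟩ := (G.relocate (insert r L) u m).exists_isDominatingSet_card_eq
    obtain ⟨D', hD', hc', hr, hm⟩ := hD.exists_mem_supports hl₂ ht₂ hrt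
    have h1 := hD'.relocate_of_adj_mem (m := u) (h.isAttached_star.relocate hmB) hm
      fun a ha ham =>
        h.eq_of_mem_of_adj ha ((relocate_adj_of_mem_of_notMem ha hmB).1 ham).2 ▸ hr
    rw [h.isAttached_star.relocate_relocate hmB] at h1
    exact h1.dominationNumber_le.trans (hc'.trans hc.le)

end IsStar

end Domination
end SimpleGraph

/-! ### Eigenvector signs on branches and strict decrease of the least eigenvalue -/

namespace SimpleGraph
open Matrix

section Perturbation

variable {V : Type*} [Fintype V] [DecidableEq V] {G : SimpleGraph V} {B : Set V} {u m : V}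
  {x : V → ℝ}

/-- For a branch joined to the rest of the graph by the single edge `au`, an eigenvector for the
least eigenvalue does not have the same sign at `a` and `u`, and it vanishes at `a` if it vanishes
at `u`. -/
theorem branch_sign (hx : G.signlessLapMatrix *ᵥ x = G.qMin • x) {a : V} (ha : a ∈ B) (hu : u ∉ B)
    (hau : G.Adj a u) (hB : ∀ b ∈ B, ∀ c, c ∉ B → G.Adj b c → b = a ∧ c = u) :
    x a * x u ≤ 0 ∧ (x u = 0 → x a = 0) := by
  classical
  -- The truncation of `x` to `B` has Rayleigh defect `-(x a * x u)`, which must be nonnegative.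
  set y : V → ℝ := fun v => if v ∈ B then x v else 0 with hy
  have hQ : ∀ v ∈ B, (G.signlessLapMatrix *ᵥ y) v = G.qMin * x v - if v = a then x u else 0 := by
    intro v hv
    rw [← sum_adj_of_mulVec_eq hx v, signlessLapMatrix_mulVec_apply, eq_sub_iff_add_eq]
    have : (if v = a then x u else 0) = ∑ b, if v = a ∧ b = u then x u else 0 := by
      by_cases hva : v = a <;> simp [hva]
    rw [this, ← Finset.sum_add_distrib]
    refine Finset.sum_congr rfl fun b _ => ?_
    by_cases hvb : G.Adj v b
    · by_cases hb : b ∈ B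
      · have : b ≠ u := fun h => hu (h ▸ hb)
        simp [hy, hv, hb, hvb, this]
      · obtain ⟨rfl, rfl⟩ := hB v hv b hb hvb
        simp [hy, hv, hb, hvb]
    · have : ¬ (v = a ∧ b = u) := fun h => hvb (h.1 ▸ h.2 ▸ hau)
      simp [hvb, this]
  have hE : G.qForm y / 2 = G.qMin * (∑ i, y i ^ 2) - x a * x u := by
    rw [← dotProduct_signlessLapMatrix_mulVec, dotProduct, Finset.mul_sum, eq_sub_iff_add_eq]
    have : x a * x u = ∑ v, if v = a then x a * x u else 0 := by simp
    rw [this, ← Finset.sum_add_distrib]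
    refine Finset.sum_congr rfl fun v _ => ?_
    by_cases hv : v ∈ B
    · rw [hQ v hv]
      by_cases hva : v = a
      · subst hva
        simp only [hy, hv, if_true]
        ring
      · simp only [hy, hv, hva, if_true, if_false]
        ring
    · have : v ≠ a := fun h => hv (h ▸ ha)
      simp [hy, hv, this]
  refine ⟨by linarith [G.two_mul_qMin_mul_le_qForm y], fun h0 => ?_⟩
  -- If `x u = 0` the defect is zero, so `y` is itself an eigenvector; its equation at `u` reads `x
  -- a = 0`.
  have h1 := sum_adj_of_mulVec_eq (G.mulVec_eq_of_qForm_le (x := y) (by rw [h0] at hE; linarith)) u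
  have h2 : y u = 0 := by simp [hy, hu]
  rw [h2, mul_zero, Finset.sum_eq_single a] at h1
  · simpa [hau.symm, hy, ha] using h1
  · intro b _ hba
    by_cases hub : G.Adj u b
    · by_cases hb : b ∈ B
      · exact absurd (hB b hb u hu hub.symm).1 hba
      · simp [hy, hb]
    · simp [hub]
  · simp

theorem pendant_sign (hx : G.signlessLapMatrix *ᵥ x = G.qMin • x) {p w : V}
    (hp : G.neighborSet p = {w}) : x p * x w ≤ 0 ∧ (x w = 0 → x p = 0) := by
  have hadj := adj_iff_of_neighborSet_eq hp
  refine branch_sign hx (B := {p}) rfl (isAttached_singleton hp).notMem ((hadj w).2 rfl) ?_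
  rintro b rfl c _ hbc
  exact ⟨rfl, (hadj c).1 hbc⟩

/-- A sign pattern for an eigenvector `x` on a branch `B` attached at `u`: it alternates along
the edges of `B`, and agrees with the signs of `x` up to the global sign `s`. -/
structure IsSignPattern (G : SimpleGraph V) (B : Set V) (u : V) (x ε : V → ℝ) (s : ℝ) : Prop where
  sq_eq_one : s ^ 2 = 1
  eps_sq : ∀ b ∈ B, ε b ^ 2 = 1
  eps_eq_one : ∀ a ∈ B, G.Adj a u → ε a = 1
  eps_neg : ∀ a ∈ B, ∀ b ∈ B, G.Adj a b → ε a = -ε b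
  nonneg : ∀ b ∈ B, 0 ≤ s * (ε b * x b)
  nonpos : s * x u ≤ 0

omit [Fintype V] [DecidableEq V] in
theorem IsSignPattern.abs_mul_eq {ε : V → ℝ} {s : ℝ} (h : G.IsSignPattern B u x ε s) (z : ℝ) :
    |s * z| = |z| := by
  have h1 : |s| = 1 :=
    (pow_eq_one_iff_of_nonneg (abs_nonneg s) two_ne_zero).1 ((sq_abs s).trans h.sq_eq_one)
  rw [abs_mul, h1, one_mul]

-- Weight the eigenvalue equations on `B` by `ε` and add them. Interior edges cancel because `ε`
-- alternates, so only the edges to `u` contribute.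
open Classical in
theorem IsSignPattern.flux {ε : V → ℝ} {s : ℝ} (h : G.IsSignPattern B u x ε s)
    (hB : G.IsAttached B u) (hx : G.signlessLapMatrix *ᵥ x = G.qMin • x) :
    (∑ v, if v ∈ B ∧ G.Adj v u then x v + x u else 0)
      = G.qMin * ∑ v, if v ∈ B then ε v * x v else 0 := by
  have h0 : (∑ v, ∑ b, if v ∈ B ∧ b ∈ B ∧ G.Adj v b then ε v * (x v + x b) else 0) = 0 := by
    have : (∑ v, ∑ b, if v ∈ B ∧ b ∈ B ∧ G.Adj v b then ε v * (x v + x b) else 0)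
        = -∑ v, ∑ b, if v ∈ B ∧ b ∈ B ∧ G.Adj v b then ε v * (x v + x b) else 0 := by
      conv_lhs => rw [Finset.sum_comm]
      rw [← Finset.sum_neg_distrib]
      refine Finset.sum_congr rfl fun v _ => ?_
      rw [← Finset.sum_neg_distrib]
      refine Finset.sum_congr rfl fun b _ => ?_
      by_cases hc : v ∈ B ∧ b ∈ B ∧ G.Adj v b
      · rw [if_pos hc, if_pos ⟨hc.2.1, hc.1, hc.2.2.symm⟩, h.eps_neg v hc.1 b hc.2.1 hc.2.2]
        ring
      · rw [if_neg hc, if_neg fun h' => hc ⟨h'.2.1, h'.1, h'.2.2.symm⟩, neg_zero]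
    linarith
  suffices h' : (∑ v, if v ∈ B ∧ G.Adj v u then x v + x u else 0)
      + (∑ v, ∑ b, if v ∈ B ∧ b ∈ B ∧ G.Adj v b then ε v * (x v + x b) else 0)
      = G.qMin * ∑ v, if v ∈ B then ε v * x v else 0 by rwa [h0, add_zero] at h'
  rw [Finset.mul_sum, ← Finset.sum_add_distrib]
  refine Finset.sum_congr rfl fun v _ => ?_
  by_cases hv : v ∈ B
  · have h1 : (if v ∈ B ∧ G.Adj v u then x v + x u else 0)
        = ∑ b, if b = u ∧ G.Adj v u then x v + x u else 0 := by
      by_cases hvu : G.Adj v u <;> simp [hv, hvu]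
    rw [if_pos hv, mul_left_comm, ← sum_adj_of_mulVec_eq hx v, h1, ← Finset.sum_add_distrib,
      Finset.mul_sum]
    refine Finset.sum_congr rfl fun b _ => ?_
    by_cases hvb : G.Adj v b
    · by_cases hb : b ∈ B
      · have : b ≠ u := fun h' => hB.notMem (h' ▸ hb)
        simp [hv, hb, hvb, this]
      · obtain rfl := hB.eq_of_adj v hv b hb hvb
        simp [hb, hvb, h.eps_eq_one v hv hvb]
    · have : ¬ (b = u ∧ G.Adj v u) := fun h' => hvb (h'.1 ▸ h'.2)
      simp [hvb, this]
  · simp [hv]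

/-- Relocating a branch to a vertex where the eigenvector is at least as large in absolute value
strictly decreases the least eigenvalue. -/
theorem IsSignPattern.qMin_relocate_lt {ε : V → ℝ} {s : ℝ} (h : G.IsSignPattern B u x ε s)
    (hB : G.IsAttached B u) (hm : m ∉ B) (hx : G.IsUnitQMinEigenvector x) (hq : 0 < G.qMin)
    (hum : u ≠ m) (hle : |x u| ≤ |x m|) (hm0 : x m ≠ 0) {a₀ : V} (ha₀ : a₀ ∈ B)
    (hadj₀ : G.Adj a₀ u) : (G.relocate B u m).qMin < G.qMin := by
  classical
  by_contra hlt
  rw [not_lt] at hlt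
  have hs := h.sq_eq_one
  have hsu : s * x u = -|x u| := by
    rw [← h.abs_mul_eq, abs_of_nonpos h.nonpos, neg_neg]
  obtain ⟨t, ht, htm⟩ : ∃ t : ℝ, t ^ 2 = 1 ∧ x m = -(t * |x m|) := by
    rcases le_total 0 (x m) with h0 | h0
    · exact ⟨-1, by norm_num, by rw [abs_of_nonneg h0]; ring⟩
    · exact ⟨1, by norm_num, by rw [abs_of_nonpos h0]; ring⟩
  set δ : ℝ := |x m| - |x u| with hδ
  have hδ0 : 0 ≤ δ := sub_nonneg.2 hle
  -- The shift `ε v * δ` cancels on interior edges and has the sign of `s * x v` wherever that is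
  -- nonzero, so absolute values grow. The sign `t` and the size of `δ` are chosen so that edges to
  -- `m` give what edges to `u` gave.
  set y : V → ℝ := fun v => if v ∈ B then t * (s * x v + ε v * δ) else x v with hy
  have hyB : ∀ v ∈ B, y v = t * (s * x v + ε v * δ) := fun v hv => if_pos hv
  have hyn : ∀ v, v ∉ B → y v = x v := fun v hv => if_neg hv
  have hts : (t * s) ^ 2 = 1 := by rw [mul_pow, ht, hs, one_mul]
  have hbd : ∀ a ∈ B, G.Adj a u → (y a + y m) ^ 2 = (x a + x u) ^ 2 := by
    intro a ha hau
    have : y a + y m = t * s * (x a + x u) := by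
      rw [hyB a ha, hyn m hm, h.eps_eq_one a ha hau]
      linear_combination htm + t * hδ - t * hsu
    rw [this, mul_pow, hts, one_mul]
  have hE : (G.relocate B u m).qForm y = G.qForm x := by
    refine hB.sum_relocate hm (F := fun a b => (x a + x b) ^ 2) (F' := fun a b => (y a + y b) ^ 2)
      ?_ ?_ hbd ?_
    · intro a b ha hb hab
      have : y a + y b = t * s * (x a + x b) := by
        rw [hyB a ha, hyB b hb, h.eps_neg a ha b hb hab]
        ring
      simp only [this, mul_pow, hts, one_mul]
    · intro a b ha hb _
      simp only [hyn a ha, hyn b hb]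
    · intro a ha hau
      rw [add_comm (y m), add_comm (x u)]
      exact hbd a ha hau
  have hpt : ∀ v, x v ^ 2 ≤ y v ^ 2 := by
    intro v
    by_cases hv : v ∈ B
    · have h1 : y v ^ 2 = x v ^ 2 + 2 * (s * (ε v * x v)) * δ + δ ^ 2 := by
        rw [hyB v hv]
        linear_combination (s * x v + ε v * δ) ^ 2 * ht + (x v) ^ 2 * hs + δ ^ 2 * h.eps_sq v hv
      have := mul_nonneg (h.nonneg v hv) hδ0
      nlinarith
    · rw [hyn v hv]
  have hN := Finset.sum_le_sum fun v (_ : v ∈ Finset.univ) => hpt v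
  have hEx := G.qForm_of_mulVec_eq hx.1
  have hR := (G.relocate B u m).two_mul_qMin_mul_le_qForm y
  rw [hE, hEx] at hR
  rw [hx.2] at hN hR hEx
  -- Without a strict decrease all inequalities are equalities, and `y` is an eigenvector for the
  -- same eigenvalue.
  have hN1 : (∑ v, y v ^ 2) = 1 := by nlinarith
  rw [hN1] at hR
  have hqq : (G.relocate B u m).qMin = G.qMin := by linarith
  have hQ := (G.relocate B u m).mulVec_eq_of_qForm_le (x := y) (by rw [hE, hEx, hN1, hqq])
  have hu := hB.notMem
  have e1 := sum_adj_of_mulVec_eq hQ u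
  have e2 := sum_adj_of_mulVec_eq hx.1 u
  rw [hqq, hyn u hu, ← e2] at e1
  -- Compare the two equations at `u`, which has lost its neighbours in `B`. By `flux`, `x` then
  -- vanishes on `B`, so `δ = 0`, and the boundary sum forces `x u = 0` against `|x u| = |x m|`.
  have e3 : (∑ v, if v ∈ B ∧ G.Adj v u then x v + x u else 0) = 0 := by
    refine Eq.trans ?_ (sub_eq_zero.2 e1.symm)
    rw [← Finset.sum_sub_distrib]
    refine Finset.sum_congr rfl fun v _ => ?_
    by_cases hv : v ∈ B
    · rw [G.adj_comm u v, adj_comm _ u v, relocate_adj_of_mem_of_notMem hv hu]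
      simp [hv, hum, add_comm]
    · rw [relocate_adj_of_notMem hu hv, hyn v hv]
      simp [hv]
  have e4 := h.flux hB hx.1
  rw [e3] at e4
  have e5 : (∑ v, if v ∈ B then s * (ε v * x v) else 0) = 0 := by
    have := (mul_eq_zero.1 e4.symm).resolve_left hq.ne'
    calc _ = s * ∑ v, if v ∈ B then ε v * x v else 0 := by
          rw [Finset.mul_sum]
          exact Finset.sum_congr rfl fun v _ => by split_ifs <;> simp
      _ = 0 := by rw [this, mul_zero]
  have e6 : ∀ v ∈ B, x v = 0 := by
    intro v hv
    have := (Finset.sum_eq_zero_iff_of_nonneg (fun v _ => by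
      split_ifs with hv
      exacts [h.nonneg v hv, le_rfl])).1 e5 v (Finset.mem_univ v)
    rw [if_pos hv] at this
    have h1 := h.eps_sq v hv
    have h2 : s ≠ 0 := fun h' => by simp [h'] at hs
    have h3 : ε v ≠ 0 := fun h' => by simp [h'] at h1
    simpa [h2, h3] using this
  have e7 : δ = 0 := by
    have h1 : (∑ v, (y v ^ 2 - x v ^ 2)) = 0 := by
      rw [Finset.sum_sub_distrib, hN1, hx.2, sub_self]
    have h2 := (Finset.sum_eq_zero_iff_of_nonneg (fun v _ => sub_nonneg.2 (hpt v))).1 h1 a₀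
      (Finset.mem_univ _)
    rw [hyB a₀ ha₀, e6 a₀ ha₀, h.eps_eq_one a₀ ha₀ hadj₀, mul_pow, ht] at h2
    simpa using h2
  have e8 : (∑ v, if v ∈ B ∧ G.Adj v u then (1 : ℝ) else 0) * x u = 0 := by
    refine Eq.trans ?_ e3
    rw [Finset.sum_mul]
    refine Finset.sum_congr rfl fun v _ => ?_
    split_ifs with hv
    · rw [e6 v hv.1]
      ring
    · ring
  have hu0 : x u ≠ 0 := by
    rw [← abs_pos]
    have := abs_pos.2 hm0
    linarith
  have e9 := (mul_eq_zero.1 e8).resolve_right hu0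
  have := (Finset.sum_eq_zero_iff_of_nonneg (fun v _ => by split_ifs <;> norm_num)).1 e9 a₀
    (Finset.mem_univ _)
  simp [ha₀, hadj₀] at this

theorem exists_isSignPattern_leaves (hx : G.signlessLapMatrix *ᵥ x = G.qMin • x) {L : Set V} {r : V}
    (hL : ∀ v ∈ L, G.neighborSet v = {r}) (hr : r ∉ L) : ∃ s, G.IsSignPattern L r x 1 s := by
  have hadj : ∀ a ∈ L, ∀ b ∈ L, ¬ G.Adj a b := fun a ha b hb hab =>
    hr ((adj_iff_of_neighborSet_eq (hL a ha) b).1 hab ▸ hb)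
  rcases le_or_gt (x r) 0 with h | h
  · refine ⟨1, by norm_num, by simp, by simp, fun a ha b hb hab => absurd hab (hadj a ha b hb), ?_,
      by simpa using h⟩
    intro b hb
    have h1 := pendant_sign hx (hL b hb)
    rcases h.eq_or_lt with h0 | h0
    · simp [h1.2 h0]
    · simp only [Pi.one_apply, one_mul]
      nlinarith
  · refine ⟨-1, by norm_num, by simp, by simp, fun a ha b hb hab => absurd hab (hadj a ha b hb), ?_,
      by simpa using h.le⟩
    intro b hb
    have h1 := pendant_sign hx (hL b hb)
    simp only [Pi.one_apply, one_mul]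
    nlinarith

theorem IsStar.exists_isSignPattern {r : V} {L : Set V} (h : G.IsStar r u L)
    (hx : G.signlessLapMatrix *ᵥ x = G.qMin • x) :
    ∃ s, G.IsSignPattern (insert r L) u x (fun v => if v = r then 1 else -1) s := by
  have hL : ∀ v ∈ L, v ≠ r := fun v hv h' => h.notMem (h' ▸ hv)
  have hsign : x r * x u ≤ 0 ∧ (x u = 0 → x r = 0) := by
    refine branch_sign hx (Set.mem_insert r L) h.isAttached_star.notMem h.adj fun b hb c hc hbc => ?_
    have := (h.isAttached_star.adj_iff hb hc).1 hbc
    exact ⟨h.eq_of_mem_of_adj hb this.2, this.1⟩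
  obtain ⟨s, hs, hsu, hsr⟩ : ∃ s : ℝ, s ^ 2 = 1 ∧ s * x u ≤ 0 ∧ 0 ≤ s * x r := by
    rcases lt_trichotomy (x u) 0 with h0 | h0 | h0
    · exact ⟨1, by norm_num, by linarith, by nlinarith⟩
    · exact ⟨1, by norm_num, by linarith, by rw [hsign.2 h0]; simp⟩
    · exact ⟨-1, by norm_num, by linarith, by nlinarith⟩
  refine ⟨s, hs, ?_, ?_, ?_, ?_, hsu⟩
  · intro b _
    split_ifs <;> norm_num
  · intro a ha hau
    exact if_pos (h.eq_of_mem_of_adj ha hau)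
  · rintro a (rfl | ha) b (rfl | hb) hab
    · exact absurd hab G.irrefl
    · simp [hL b hb]
    · simp [hL a ha]
    · exact absurd ((h.adj_iff ha b).1 hab) (hL b hb)
  · rintro b (rfl | hb)
    · simpa using hsr
    · have h1 := pendant_sign hx (h.neighborSet_eq b hb)
      simp only [hL b hb, if_false]
      by_cases h0 : x r = 0
      · simp [h1.2 h0]
      · have h2 : 0 < (s * x r) := lt_of_le_of_ne hsr fun h' => by
          rcases mul_eq_zero.1 h'.symm with h3 | h3
          · simp [h3] at hs
          · exact h0 h3
        have h3 : (s * x b) * (s * x r) ≤ 0 := by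
          have : (s * x b) * (s * x r) = s ^ 2 * (x b * x r) := by ring
          rw [this, hs, one_mul]
          exact h1.1
        nlinarith

/-- An eigenvector for the least eigenvalue is larger at the centre of a star than at the vertex
at which the star is attached. -/
theorem IsStar.abs_le {r : V} {L : Set V} (h : G.IsStar r u L)
    (hx : G.signlessLapMatrix *ᵥ x = G.qMin • x) (hq : 0 < G.qMin) :
    |x u| + G.qMin * |x r| ≤ |x r| := by
  classical
  obtain ⟨s, hs⟩ := h.exists_isSignPattern hx
  obtain ⟨B, hB⟩ : ∃ B, B = insert r L := ⟨_, rfl⟩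
  have hatt := h.isAttached_star
  rw [← hB] at hs hatt
  have hf := hs.flux hatt hx
  have hrB : r ∈ B := hB ▸ Set.mem_insert r L
  have h1 : (∑ v, if v ∈ B ∧ G.Adj v u then x v + x u else 0) = x r + x u := by
    rw [Finset.sum_eq_single r]
    · simp [h.adj, hrB]
    · intro b _ hb
      exact if_neg fun h' => hb (h.eq_of_mem_of_adj (hB ▸ h'.1) h'.2)
    · simp
  rw [h1] at hf
  -- All terms of the flux sum are nonnegative after multiplication by `s`; only the one at `r` is
  -- kept.
  have h2 : s * x r ≤ s * ∑ v, if v ∈ B then (if v = r then 1 else -1) * x v else 0 := by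
    rw [Finset.mul_sum]
    refine le_trans ?_ (Finset.single_le_sum (fun v _ => ?_) (Finset.mem_univ r))
    · simp [hrB]
    · split_ifs with hv
      · have := hs.nonneg v hv
        simp_all
      · have := hs.nonneg v hv
        simp_all
      · simp
  have h3 := hs.nonneg r hrB
  simp only [if_true, one_mul] at h3
  have h4 := hs.nonpos
  rw [← hs.abs_mul_eq (x u), ← hs.abs_mul_eq (x r), abs_of_nonneg h3, abs_of_nonpos h4]
  have h5 := mul_le_mul_of_nonneg_left h2 hq.le
  have h6 := congrArg (s * ·) hf
  linarith

end Perturbation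
end SimpleGraph

/-! ### Unicyclic graphs as a cycle with rooted trees -/

namespace SimpleGraph
open Matrix

/-- The structure of a unicyclic graph: a cycle `c 0, c 1, …, c g = c 0`, and rooted trees
attached to it, given by a parent function `p` and a depth function `d`. -/
structure CycleForest {V : Type*} (G : SimpleGraph V) (g : ℕ) (c : ℕ → V) (p : V → V)
    (d : V → ℕ) : Prop where
  three_le : 3 ≤ g
  c_eq_iff : ∀ i j, c i = c j ↔ i ≡ j [MOD g]
  depth_eq_zero_iff : ∀ v, d v = 0 ↔ ∃ i, c i = v
  depth_parent : ∀ v, d v ≠ 0 → d (p v) + 1 = d v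
  adj_iff : ∀ a b, G.Adj a b ↔ (∃ i, a = c i ∧ b = c (i + 1)) ∨ (∃ i, b = c i ∧ a = c (i + 1)) ∨
    (d a ≠ 0 ∧ b = p a) ∨ (d b ≠ 0 ∧ a = p b)

/-- The depth is the distance to `C`, and the parent is the first step of a shortest walk. -/
theorem exists_depth {V : Type*} {G : SimpleGraph V} (hc : G.Connected) {C : Set V}
    (hC : C.Nonempty) : ∃ (p : V → V) (d : V → ℕ), (∀ v, d v = 0 ↔ v ∈ C) ∧
      ∀ v, d v ≠ 0 → G.Adj v (p v) ∧ d (p v) + 1 = d v := by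
  classical
  have hex : ∀ v, ∃ k, ∃ (z : V) (w : G.Walk v z), z ∈ C ∧ w.length = k := fun v =>
    let ⟨z, hz⟩ := hC
    ⟨_, z, (hc.preconnected v z).some, hz, rfl⟩
  have hpar : ∀ v, Nat.find (hex v) ≠ 0 →
      ∃ u, G.Adj v u ∧ Nat.find (hex u) + 1 = Nat.find (hex v) := by
    intro v hv
    obtain ⟨z, w, hz, hw⟩ := Nat.find_spec (hex v)
    cases w with
    | nil => exact absurd hw.symm hv
    | @cons _ u _ h q =>
      refine ⟨u, h, ?_⟩
      have h1 : Nat.find (hex u) ≤ q.length := Nat.find_min' _ ⟨z, q, hz, rfl⟩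
      obtain ⟨z', w', hz', hw'⟩ := Nat.find_spec (hex u)
      have h2 : Nat.find (hex v) ≤ w'.length + 1 :=
        Nat.find_min' _ ⟨z', w'.cons h, hz', Walk.length_cons _ _⟩
      rw [Walk.length_cons] at hw
      omega
  choose! p hp using hpar
  refine ⟨p, fun v => Nat.find (hex v), fun v => ?_, hp⟩
  · rw [Nat.find_eq_zero]
    constructor
    · rintro ⟨z, w, hz, hw⟩
      exact (Walk.eq_of_length_eq_zero hw) ▸ hz
    · exact fun hv => ⟨v, Walk.nil, hv, rfl⟩

theorem exists_cycleForest {V : Type*} [Fintype V] {G : SimpleGraph V} (hG : G.IsUnicyclic)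
    (ha : ¬ G.IsAcyclic) : ∃ c p d, G.CycleForest G.girth c p d := by
  classical
  obtain ⟨a, w, hw, hg⟩ := exists_girth_eq_length.2 ha
  have h3 : 3 ≤ G.girth := three_le_girth ha
  have hg0 : 0 < G.girth := by omega
  obtain ⟨p, d, hd0, hp⟩ := exists_depth hG.1 (C := {v | v ∈ w.support}) ⟨a, w.start_mem_support⟩
  set g := G.girth with hgdef
  set c : ℕ → V := fun i => w.getVert (i % g) with hc
  have hcg : ∀ i ≤ g, w.getVert i = c i := by
    intro i hi
    rcases hi.eq_or_lt with rfl | hi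
    · simp only [hc, Nat.mod_self, Walk.getVert_zero]
      rw [hg, Walk.getVert_length]
    · simp only [hc, Nat.mod_eq_of_lt hi]
  have hcmod : ∀ i, c (i % g) = c i := fun i => by simp [hc]
  have hsupp : ∀ v, v ∈ w.support ↔ ∃ i, c i = v := by
    intro v
    rw [Walk.mem_support_iff_exists_getVert]
    constructor
    · rintro ⟨i, rfl, hi⟩
      exact ⟨i, (hcg i (hg ▸ hi)).symm⟩
    · rintro ⟨i, rfl⟩
      exact ⟨i % g, rfl, hg ▸ (Nat.mod_lt _ hg0).le⟩
  have hcinj : ∀ i j, c i = c j ↔ i ≡ j [MOD g] := by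
    intro i j
    refine ⟨fun h => hw.getVert_injOn' ?_ ?_ h, fun h => ?_⟩
    · have := Nat.mod_lt i hg0
      simp only [Set.mem_ofPred_eq]
      omega
    · have := Nat.mod_lt j hg0
      simp only [Set.mem_ofPred_eq]
      omega
    · simp only [hc]
      rw [h]
  have hmem : ∀ e ∈ w.edges, ∃ i, e = s(c i, c (i + 1)) := by
    intro e he
    induction e using Sym2.ind with
    | _ x y =>
    obtain ⟨i, hi, h⟩ := (w.mk_mem_edges_iff_exists).1 he
    exact ⟨i, by rw [← h, hcg i (by omega), hcg (i + 1) (by omega)]⟩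
  have hcadj : ∀ i, G.Adj (c i) (c (i + 1)) := by
    intro i
    have hi := Nat.mod_lt i hg0
    have h1 := w.adj_getVert_succ (i := i % g) (by omega)
    rwa [hcg _ hi.le, hcg _ hi, hcmod, (hcinj (i % g + 1) (i + 1)).2] at h1
    exact (Nat.mod_modEq i g).add_right 1
  set E₁ : Finset (Sym2 V) := w.edges.toFinset with hE₁
  set T : Finset V := Finset.univ.filter fun v => d v ≠ 0 with hT
  set E₂ : Finset (Sym2 V) := T.image fun v => s(v, p v) with hE₂
  have hcard₁ : E₁.card = g := by
    rw [hE₁, List.toFinset_card_of_nodup hw.edges_nodup, Walk.length_edges, hg]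
  have hcardC : (Finset.univ.filter fun v => d v = 0).card = g := by
    have : (Finset.univ.filter fun v => d v = 0) = (Finset.range g).image c := by
      ext v
      simp only [Finset.mem_filter, Finset.mem_univ, true_and, hd0, Finset.mem_image,
        Finset.mem_range]
      rw [Set.mem_ofPred_eq, hsupp]
      exact ⟨fun ⟨i, hi⟩ => ⟨i % g, Nat.mod_lt _ hg0, (hcmod i).trans hi⟩,
        fun ⟨i, _, hi⟩ => ⟨i, hi⟩⟩
    rw [this, Finset.card_image_of_injOn, Finset.card_range]
    intro i hi j hj hij
    exact Nat.ModEq.eq_of_lt_of_lt ((hcinj i j).1 hij) (Finset.mem_range.1 hi)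
      (Finset.mem_range.1 hj)
  have hcard₂ : E₂.card = T.card := by
    refine Finset.card_image_of_injOn fun v hv v' hv' h => ?_
    have hv := (Finset.mem_filter.1 hv).2
    have hv' := (Finset.mem_filter.1 hv').2
    rcases Sym2.eq_iff.1 h with h | h
    · exact h.1
    · have h1 := (hp v hv).2
      have h2 := (hp v' hv').2
      rw [h.2] at h1
      rw [← h.1] at h2
      omega
  have hdisj : Disjoint E₁ E₂ := by
    rw [Finset.disjoint_left]
    intro e h1 h2
    obtain ⟨v, hv, rfl⟩ := Finset.mem_image.1 h2
    have hv := (Finset.mem_filter.1 hv).2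
    refine hv ((hd0 v).2 ?_)
    exact w.fst_mem_support_of_mem_edges (List.mem_toFinset.1 h1)
  have hsub : E₁ ∪ E₂ ⊆ G.edgeFinset := by
    intro e he
    rw [mem_edgeFinset]
    rcases Finset.mem_union.1 he with h | h
    · exact w.edges_subset_edgeSet (List.mem_toFinset.1 h)
    · obtain ⟨v, hv, rfl⟩ := Finset.mem_image.1 h
      exact (hp v (Finset.mem_filter.1 hv).2).1
  -- There are `g` cycle edges and one parent edge for each vertex off the cycle, as many in all as
  -- vertices; so no other edges exist.
  have hall : E₁ ∪ E₂ = G.edgeFinset := by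
    refine Finset.eq_of_subset_of_card_le hsub ?_
    have h1 := hG.2
    rw [← coe_edgeFinset, Set.ncard_coe_finset, Nat.card_eq_fintype_card] at h1
    rw [h1, Finset.card_union_of_disjoint hdisj, hcard₁, hcard₂, ← hcardC, ← Finset.card_univ]
    exact (Finset.card_filter_add_card_filter_not (s := Finset.univ) fun v => d v = 0).ge
  refine ⟨c, p, d, h3, hcinj, fun v => (hd0 v).trans (hsupp v), fun v hv => (hp v hv).2,
    fun x y => ⟨fun h => ?_, ?_⟩⟩
  · have h1 : s(x, y) ∈ E₁ ∪ E₂ := hall ▸ mem_edgeFinset.2 h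
    rcases Finset.mem_union.1 h1 with h1 | h1
    · obtain ⟨i, hi⟩ := hmem _ (List.mem_toFinset.1 h1)
      rcases Sym2.eq_iff.1 hi with hi | hi
      · exact Or.inl ⟨i, hi⟩
      · exact Or.inr (Or.inl ⟨i, hi.2, hi.1⟩)
    · obtain ⟨v, hv, hi⟩ := Finset.mem_image.1 h1
      have hv := (Finset.mem_filter.1 hv).2
      rcases Sym2.eq_iff.1 hi with ⟨rfl, rfl⟩ | ⟨rfl, rfl⟩
      · exact Or.inr (Or.inr (Or.inl ⟨hv, rfl⟩))
      · exact Or.inr (Or.inr (Or.inr ⟨hv, rfl⟩))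
  · rintro (⟨i, rfl, rfl⟩ | ⟨i, rfl, rfl⟩ | ⟨h, rfl⟩ | ⟨h, rfl⟩)
    · exact hcadj i
    · exact (hcadj i).symm
    · exact (hp x h).1
    · exact (hp y h).1.symm

theorem not_isAcyclic_of_not_isBipartite {V : Type*} {G : SimpleGraph V} (h : ¬ G.IsBipartite) :
    ¬ G.IsAcyclic := fun h' => h h'.isBipartite

theorem isPendant_iff {V : Type*} {G : SimpleGraph V} {v : V} :
    G.IsPendant v ↔ ∃ w, G.neighborSet v = {w} := Set.ncard_eq_one

namespace CycleForest

variable {V : Type*} {G : SimpleGraph V} {g : ℕ} {c : ℕ → V} {p : V → V} {d : V → ℕ}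

theorem shift (h : G.CycleForest g c p d) (k : ℕ) :
    G.CycleForest g (fun i => c (i + k)) p d where
  three_le := h.three_le
  c_eq_iff i j := by
    rw [h.c_eq_iff]
    exact ⟨fun h' => Nat.ModEq.add_right_cancel' k h', fun h' => h'.add_right k⟩
  depth_eq_zero_iff v := by
    rw [h.depth_eq_zero_iff]
    -- `g * k - k` is a natural number representing `-k` modulo `g`.
    refine ⟨fun ⟨i, hi⟩ => ⟨i + (g * k - k), ?_⟩, fun ⟨i, hi⟩ => ⟨_, hi⟩⟩
    have h1 : k ≤ g * k := Nat.le_mul_of_pos_left k (by have := h.three_le; omega)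
    rw [← hi, h.c_eq_iff, add_assoc, Nat.sub_add_cancel h1]
    simp [Nat.ModEq]
  depth_parent := h.depth_parent
  adj_iff a b := by
    rw [h.adj_iff]
    have key : ∀ a b, (∃ i, a = c i ∧ b = c (i + 1)) ↔
        ∃ i, a = c (i + k) ∧ b = c (i + 1 + k) := by
      intro a b
      constructor
      · rintro ⟨i, rfl, rfl⟩
        have h1 : k ≤ g * k := Nat.le_mul_of_pos_left k (by have := h.three_le; omega)
        refine ⟨i + (g * k - k), ?_, ?_⟩ <;> rw [h.c_eq_iff]
        · rw [add_assoc, Nat.sub_add_cancel h1]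
          simp [Nat.ModEq]
        · rw [show i + (g * k - k) + 1 + k = i + 1 + g * k by omega]
          simp [Nat.ModEq]
      · rintro ⟨i, rfl, rfl⟩
        exact ⟨i + k, rfl, by rw [add_right_comm]⟩
    rw [key a b, key b a]

theorem depth_c (h : G.CycleForest g c p d) (i : ℕ) : d (c i) = 0 :=
  (h.depth_eq_zero_iff _).2 ⟨i, rfl⟩

theorem c_add (h : G.CycleForest g c p d) (i : ℕ) : c (i + g) = c i :=
  (h.c_eq_iff _ _).2 (by simp [Nat.ModEq])

theorem adj_c (h : G.CycleForest g c p d) (i : ℕ) : G.Adj (c i) (c (i + 1)) :=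
  (h.adj_iff _ _).2 (Or.inl ⟨i, rfl, rfl⟩)

theorem adj_c_pred (h : G.CycleForest g c p d) (i : ℕ) : G.Adj (c i) (c (i + (g - 1))) := by
  have := h.adj_c (i + (g - 1))
  rw [show i + (g - 1) + 1 = i + g by have := h.three_le; omega, h.c_add] at this
  exact this.symm

theorem c_succ_ne (h : G.CycleForest g c p d) (i : ℕ) : c (i + 1) ≠ c (i + (g - 1)) := by
  rw [Ne, h.c_eq_iff]
  intro h'
  have h3 := h.three_le
  have h1 := Nat.ModEq.add_left_cancel' i h'
  have := h1.eq_of_lt_of_lt (by omega) (by omega)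
  omega

theorem adj_parent (h : G.CycleForest g c p d) {v : V} (hv : d v ≠ 0) : G.Adj v (p v) :=
  (h.adj_iff _ _).2 (Or.inr (Or.inr (Or.inl ⟨hv, rfl⟩)))

theorem adj_cases (h : G.CycleForest g c p d) {v b : V} (hv : d v ≠ 0) (hvb : G.Adj v b) :
    b = p v ∨ (d b ≠ 0 ∧ p b = v) := by
  rcases (h.adj_iff _ _).1 hvb with ⟨i, rfl, -⟩ | ⟨i, -, rfl⟩ | ⟨-, rfl⟩ | ⟨hb, rfl⟩
  · exact absurd (h.depth_c i) hv
  · exact absurd (h.depth_c _) hv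
  · exact Or.inl rfl
  · exact Or.inr ⟨hb, rfl⟩

theorem adj_c_cases (h : G.CycleForest g c p d) {i : ℕ} {b : V} (hb : G.Adj (c i) b) :
    b = c (i + 1) ∨ b = c (i + (g - 1)) ∨ (d b ≠ 0 ∧ p b = c i) := by
  have h3 := h.three_le
  rcases (h.adj_iff _ _).1 hb with ⟨j, hj, rfl⟩ | ⟨j, rfl, hj⟩ | ⟨h0, -⟩ | ⟨hb, h0⟩
  · left
    rw [h.c_eq_iff] at hj ⊢
    exact hj.symm.add_right 1
  · right; left
    rw [h.c_eq_iff] at hj ⊢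
    have : j + 1 + (g - 1) ≡ i + (g - 1) [MOD g] := hj.symm.add_right _
    rw [show j + 1 + (g - 1) = j + g by omega] at this
    exact Nat.ModEq.trans (by simp [Nat.ModEq]) this
  · exact absurd (h.depth_c i) h0
  · exact Or.inr (Or.inr ⟨hb, h0.symm⟩)

theorem depth_ne_zero_of_isPendant (h : G.CycleForest g c p d) {v : V} (hv : G.IsPendant v) :
    d v ≠ 0 := by
  intro h0
  obtain ⟨i, rfl⟩ := (h.depth_eq_zero_iff v).1 h0
  obtain ⟨w, hw⟩ := isPendant_iff.1 hv
  have hadj := adj_iff_of_neighborSet_eq hw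
  exact h.c_succ_ne i (((hadj _).1 (h.adj_c i)).trans ((hadj _).1 (h.adj_c_pred i)).symm)

theorem neighborSet_of_isPendant (h : G.CycleForest g c p d) {v : V} (hv : G.IsPendant v) :
    G.neighborSet v = {p v} := by
  obtain ⟨w, hw⟩ := isPendant_iff.1 hv
  rw [hw, (adj_iff_of_neighborSet_eq hw _).1 (h.adj_parent (h.depth_ne_zero_of_isPendant hv))]

theorem not_isPendant_parent (h : G.CycleForest g c p d) {v : V} (hv : d v ≠ 0) :
    ¬ G.IsPendant (p v) := by
  intro hp
  have h0 := h.depth_ne_zero_of_isPendant hp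
  have hN := h.neighborSet_of_isPendant hp
  have h1 := (adj_iff_of_neighborSet_eq hN _).1 (h.adj_parent hv).symm
  have h2 := h.depth_parent v hv
  have h3 := h.depth_parent _ h0
  rw [← h1] at h3
  omega

theorem not_isPendant_of_isSupport (h : G.CycleForest g c p d) {w : V} (hw : G.IsSupport w) :
    ¬ G.IsPendant w := by
  obtain ⟨t, hwt, ht⟩ := hw
  have h1 := (adj_iff_of_neighborSet_eq (h.neighborSet_of_isPendant ht) _).1 hwt.symm
  exact h1 ▸ h.not_isPendant_parent (h.depth_ne_zero_of_isPendant ht)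

theorem exists_child (h : G.CycleForest g c p d) {v : V} (hv : d v ≠ 0) (hp : ¬ G.IsPendant v) :
    ∃ b, G.Adj v b ∧ b ≠ p v ∧ d b = d v + 1 ∧ p b = v := by
  by_contra! hn
  refine hp (isPendant_iff.2 ⟨p v, ?_⟩)
  ext b
  rw [mem_neighborSet, Set.mem_singleton_iff]
  refine ⟨fun hb => ?_, fun hb => hb ▸ h.adj_parent hv⟩
  by_contra hbp
  rcases h.adj_cases hv hb with h1 | h1
  · exact hbp h1
  · have := h.depth_parent b h1.1
    rw [h1.2] at this
    exact hn b hb hbp this.symm h1.2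

theorem depth_iterate (h : G.CycleForest g c p d) (v : V) {j : ℕ} (hj : j ≤ d v) :
    d (p^[j] v) = d v - j := by
  induction j with
  | zero => rfl
  | succ j ih =>
    rw [Function.iterate_succ_apply']
    have h1 := ih (by omega)
    have h2 := h.depth_parent (p^[j] v) (by omega)
    omega

/-- Induction on vertices from the largest depth downwards. -/
theorem induction_down [Fintype V] (d : V → ℕ) {P : V → Prop}
    (hP : ∀ v, (∀ b, d b = d v + 1 → P b) → P v) (v : V) : P v := by
  have hle : ∀ v, d v ≤ Finset.univ.sup d := fun v => Finset.le_sup (Finset.mem_univ v)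
  induction hk : Finset.univ.sup d - d v generalizing v with
  | zero =>
    refine hP v fun b hb => ?_
    have := hle b
    have := hle v
    omega
  | succ k ih =>
    refine hP v fun b hb => ih b ?_
    have := hle b
    omega

/-- Below every nonpendant vertex off the cycle there is the centre of a star. -/
theorem exists_isStar [Fintype V] (h : G.CycleForest g c p d) (v : V) (hv : d v ≠ 0)
    (hp : ¬ G.IsPendant v) :
    ∃ r L k, G.IsStar r (p r) L ∧ v = p^[k] r ∧ d r = d v + k := by
  revert hv hp
  refine induction_down d (P := fun v => d v ≠ 0 → ¬ G.IsPendant v →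
    ∃ r L k, G.IsStar r (p r) L ∧ v = p^[k] r ∧ d r = d v + k) (fun v ih hv hp => ?_) v
  by_cases hch : ∃ b, p b = v ∧ d b = d v + 1 ∧ ¬ G.IsPendant b
  · obtain ⟨b, hb, hdb, hbp⟩ := hch
    obtain ⟨r, L, k, hs, hk, hd⟩ := ih b hdb (by omega) hbp
    exact ⟨r, L, k + 1, hs, by rw [Function.iterate_succ_apply', ← hk, hb], by omega⟩
  · push Not at hch
    -- All children are pendant, so `v` itself is a star centre.
    refine ⟨v, {b | G.Adj v b ∧ b ≠ p v}, 0, ⟨h.adj_parent hv, fun _ => Iff.rfl, ?_, ?_⟩, rfl, rfl⟩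
    · rintro b ⟨hb, hbp⟩
      obtain ⟨hb0, hbv⟩ := (h.adj_cases hv hb).resolve_left hbp
      have := h.depth_parent b hb0
      rw [hbv] at this
      rw [h.neighborSet_of_isPendant (hch b hbv this.symm), hbv]
    · obtain ⟨b, hb, hbp, -⟩ := h.exists_child hv hp
      exact ⟨b, hb, hbp⟩

/-- An eigenvector for the least eigenvalue does not vanish at all support vertices. -/
theorem exists_isSupport_ne_zero [Fintype V] [DecidableEq V] (h : G.CycleForest g c p d)
    {x : V → ℝ} (hx : G.IsUnitQMinEigenvector x) (hq : 0 < G.qMin) {v₀ : V} (hv₀ : d v₀ ≠ 0) :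
    ∃ w, G.IsSupport w ∧ x w ≠ 0 := by
  classical
  by_contra! hs
  -- Zeros climb from the support vertices: `x` vanishes on every tree, including its root on the
  -- cycle.
  have hz : ∀ v, d v ≠ 0 → x v = 0 ∧ x (p v) = 0 := by
    refine induction_down d fun v ih hv => ?_
    by_cases hp : G.IsPendant v
    · have hN := h.neighborSet_of_isPendant hp
      have h1 : x (p v) = 0 := hs _ ⟨v, (h.adj_parent hv).symm, hp⟩
      exact ⟨(pendant_sign hx.1 hN).2 h1, h1⟩
    · obtain ⟨b, -, -, hdb, hpb⟩ := h.exists_child hv hp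
      have h1 : x v = 0 := hpb ▸ (ih b hdb (by omega)).2
      refine ⟨h1, ?_⟩
      have h2 := sum_adj_of_mulVec_eq hx.1 v
      rw [h1, mul_zero, Finset.sum_eq_single (p v)] at h2
      · simpa [h.adj_parent hv] using h2
      · intro b _ hb
        split_ifs with hvb
        · obtain ⟨hb0, hbv⟩ := (h.adj_cases hv hvb).resolve_left hb
          have := h.depth_parent b hb0
          rw [hbv] at this
          rw [(ih b this.symm hb0).1, add_zero]
        · rfl
      · simp
  have hsum : ∀ y : V → ℝ, (∀ v, d v ≠ 0 → y v + y (p v) = 0) → ∀ i,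
      (∑ b, if G.Adj (c i) b then y (c i) + y b else 0)
        = (y (c i) + y (c (i + 1))) + (y (c i) + y (c (i + (g - 1)))) := by
    intro y hy i
    rw [Finset.sum_eq_add (c (i + 1)) (c (i + (g - 1))) (h.c_succ_ne i), if_pos (h.adj_c i),
      if_pos (h.adj_c_pred i)]
    · rintro b - ⟨hb1, hb2⟩
      split_ifs with hb
      · obtain ⟨hb0, hbc⟩ := ((h.adj_c_cases hb).resolve_left hb1).resolve_left hb2
        rw [← hbc, add_comm, hy b hb0]
      · rfl
    · simp
    · simp
  obtain ⟨i₀, hi₀⟩ : ∃ i, x (c i) ≠ 0 := by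
    by_contra! hn
    have h1 : ∀ v, x v = 0 := by
      intro v
      by_cases hv : d v = 0
      · obtain ⟨i, rfl⟩ := (h.depth_eq_zero_iff v).1 hv
        exact hn i
      · exact (hz v hv).1
    have := hx.2
    simp [h1] at this
  have hroot : ∀ v, ∃ i, c i = p^[d v] v := fun v =>
    (h.depth_eq_zero_iff _).1 (by rw [h.depth_iterate v le_rfl, Nat.sub_self])
  choose ρ hρ using hroot
  -- Rotate the cycle values of `x` so that a nonzero one lands on the root of the tree of `v₀`,
  -- then extend into the trees with alternating signs.
  set k : ℕ := i₀ + (g * ρ v₀ - ρ v₀) with hk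
  set y : V → ℝ := fun v => (-1) ^ d v * x (c (ρ v + k)) with hy
  have hyp : ∀ v, d v ≠ 0 → y v + y (p v) = 0 := by
    intro v hv
    have h1 := h.depth_parent v hv
    have h2 : c (ρ (p v)) = c (ρ v) := by
      rw [hρ, hρ, ← h1, Function.iterate_succ_apply]
    have h3 : c (ρ (p v) + k) = c (ρ v + k) :=
      (h.c_eq_iff _ _).2 (((h.c_eq_iff _ _).1 h2).add_right k)
    simp only [hy]
    rw [h3, ← h1, pow_succ]
    ring
  have hyc : ∀ i, y (c i) = x (c (i + k)) := by
    intro i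
    have h1 : c (ρ (c i)) = c i := by rw [hρ, h.depth_c]; rfl
    have h2 : c (ρ (c i) + k) = c (i + k) :=
      (h.c_eq_iff _ _).2 (((h.c_eq_iff _ _).1 h1).add_right k)
    simp only [hy]
    rw [h2, h.depth_c, pow_zero, one_mul]
  have hyv₀ : y v₀ ≠ 0 := by
    have h1 : c (ρ v₀ + k) = c i₀ := by
      rw [h.c_eq_iff, hk]
      have : ρ v₀ ≤ g * ρ v₀ := Nat.le_mul_of_pos_left _ (by have := h.three_le; omega)
      rw [show ρ v₀ + (i₀ + (g * ρ v₀ - ρ v₀)) = i₀ + g * ρ v₀ by omega]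
      simp [Nat.ModEq]
    simp only [hy]
    rw [h1]
    exact mul_ne_zero (pow_ne_zero _ (by norm_num)) hi₀
  have hQ0 : ∀ v, d v ≠ 0 → (G.signlessLapMatrix *ᵥ y) v = 0 := by
    intro v hv
    rw [signlessLapMatrix_mulVec_apply]
    refine Finset.sum_eq_zero fun b _ => ?_
    split_ifs with hvb
    · rcases h.adj_cases hv hvb with rfl | ⟨hb0, rfl⟩
      · exact hyp v hv
      · rw [add_comm, hyp b hb0]
    · rfl
  have hQ1 : ∀ v, d v = 0 → (G.signlessLapMatrix *ᵥ y) v = G.qMin * y v := by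
    intro v hv
    obtain ⟨i, rfl⟩ := (h.depth_eq_zero_iff v).1 hv
    have hxp : ∀ v, d v ≠ 0 → x v + x (p v) = 0 := fun v hv => by
      rw [(hz v hv).1, (hz v hv).2, add_zero]
    rw [signlessLapMatrix_mulVec_apply, hsum y hyp, hyc, hyc, hyc, ← sum_adj_of_mulVec_eq hx.1,
      hsum x hxp, add_right_comm i 1 k, add_right_comm i (g - 1) k]
  have hE := G.dotProduct_signlessLapMatrix_mulVec y
  have hR := G.two_mul_qMin_mul_le_qForm y
  -- Tree edges contribute nothing, so `y` obeys the eigenvalue equation on the cycle and is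
  -- annihilated off it. As `y v₀ ≠ 0`, its Rayleigh quotient falls below `qMin`.
  have hlt : y ⬝ᵥ (G.signlessLapMatrix *ᵥ y) < G.qMin * ∑ v, y v ^ 2 := by
    rw [dotProduct, Finset.mul_sum]
    refine Finset.sum_lt_sum (fun v _ => ?_) ⟨v₀, Finset.mem_univ _, ?_⟩
    · by_cases hv : d v = 0
      · rw [hQ1 v hv]
        exact le_of_eq (by ring)
      · rw [hQ0 v hv, mul_zero]
        positivity
    · rw [hQ0 v₀ hv₀, mul_zero]
      positivity
  linarith

theorem exists_depth_ne_zero [Fintype V] (h : G.CycleForest g c p d)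
    (hg : g + 1 ≤ Fintype.card V) : ∃ v, d v ≠ 0 := by
  classical
  by_contra! h0
  have : (Finset.univ : Finset V) ⊆ (Finset.range g).image c := by
    intro v _
    obtain ⟨i, rfl⟩ := (h.depth_eq_zero_iff v).1 (h0 v)
    exact Finset.mem_image.2 ⟨i % g, Finset.mem_range.2 (Nat.mod_lt _ (by
      have := h.three_le; omega)), (h.c_eq_iff _ _).2 (Nat.mod_modEq i g)⟩
  have h1 := (Finset.card_le_card this).trans Finset.card_image_le
  rw [Finset.card_univ, Finset.card_range] at h1
  omega

end CycleForest
end SimpleGraph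

/-! ### Constructing and analysing labellings -/

namespace SimpleGraph
open Matrix

theorem lollipop_adj_iff {g l i j : ℕ} (hi : 1 ≤ i) (hij : i < j) : (lollipop g l).Adj i j ↔
    (1 ≤ i ∧ j = i + 1 ∧ j ≤ g + l) ∨ (i = 1 ∧ j = g) := by
  rw [lollipop, fromRel_adj]
  constructor
  · rintro ⟨-, h | h⟩
    · exact h
    · have h' : (1 ≤ j ∧ i = j + 1 ∧ i ≤ g + l) ∨ (j = 1 ∧ i = g) := h
      omega
  · exact fun h => ⟨hij.ne, Or.inl h⟩

/-- Nonadjacency to itself and symmetry reduce the comparison of two graphs along a map to ordered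
pairs. -/
theorem adj_iff_of_lt {V : Type*} {G : SimpleGraph V} {H : SimpleGraph ℕ} {v : ℕ → V} {s : Set ℕ}
    (h : ∀ i ∈ s, ∀ j ∈ s, i < j → (G.Adj (v i) (v j) ↔ H.Adj i j)) :
    ∀ i ∈ s, ∀ j ∈ s, (G.Adj (v i) (v j) ↔ H.Adj i j) := by
  intro i hi j hj
  rcases lt_trichotomy i j with hij | rfl | hij
  · exact h i hi j hj hij
  · simp
  · rw [G.adj_comm, H.adj_comm]
    exact h j hj i hi hij

/-- Each nonpendant vertex off the cycle is an ancestor of a star centre, or one itself. As `m` is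
the only possible centre, such vertices lie on the path from the cycle to `m`; all other vertices
off the cycle are pendant. -/
theorem CycleForest.exists_isFLabelling {V : Type*} [Fintype V] {G : SimpleGraph V} {g : ℕ}
    {c : ℕ → V} {p : V → V} {d : V → ℕ} (h : G.CycleForest g c p d) {m : V}
    (hm : G.IsSupport m) (hstar : ∀ r L, G.IsStar r (p r) L → r = m)
    (hmulti : ∀ w, w ≠ m → (G.pendantNeighborSet w).ncard ≤ 1) :
    ∃ v, G.IsFLabelling g (d m + 1) v ∧ v (g + d m) = m := by
  have h3 := h.three_le
  obtain ⟨t, hmt, ht⟩ := hm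
  have hNt := h.neighborSet_of_isPendant ht
  have hdt := h.depth_ne_zero_of_isPendant ht
  have hpt : p t = m := ((adj_iff_of_neighborSet_eq hNt m).1 hmt.symm).symm
  have hdt' : d t = d m + 1 := by rw [← h.depth_parent t hdt, hpt]
  have hroot : d (p^[d m] m) = 0 := by rw [h.depth_iterate m le_rfl, Nat.sub_self]
  obtain ⟨k, hk⟩ := (h.depth_eq_zero_iff _).1 hroot
  replace h := h.shift k
  obtain ⟨c', hc'⟩ : ∃ c', c' = fun i => c (i + k) := ⟨_, rfl⟩
  have hc0 : c' g = p^[d m] m := by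
    rw [← hk, hc']
    have := h.c_add 0
    simpa using this
  rw [← hc'] at h
  -- The cycle is rotated so that index `g` is the root above `m`; the path descends to `m` and ends
  -- in its pendant neighbour `t`, whence `l = d m + 1`.
  set v : ℕ → V := fun i => if i ≤ g then c' i else if i ≤ g + d m then p^[g + d m - i] m else t
    with hv
  have hvc : ∀ i ≤ g, v i = c' i := fun i hi => if_pos hi
  have hvp : ∀ j ≤ d m, v (g + j) = p^[d m - j] m := by
    intro j hj
    rcases Nat.eq_zero_or_pos j with rfl | hj0
    · rw [add_zero, hvc g le_rfl, hc0, Nat.sub_zero]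
    · simp only [hv]
      rw [if_neg (by omega), if_pos (by omega), show g + d m - (g + j) = d m - j by omega]
  have hvt : v (g + (d m + 1)) = t := by
    simp only [hv]
    rw [if_neg (by omega), if_neg (by omega)]
  have hvm : v (g + d m) = m := by rw [hvp _ le_rfl, Nat.sub_self]; rfl
  have hdepth : ∀ i ≤ g + (d m + 1), d (v i) = i - g := by
    intro i hi
    by_cases hig : i ≤ g
    · rw [hvc i hig, h.depth_c]
      omega
    · obtain ⟨j, rfl⟩ : ∃ j, i = g + j := ⟨i - g, by omega⟩
      by_cases hj : j ≤ d m
      · rw [hvp j hj, h.depth_iterate m (by omega)]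
        omega
      · obtain rfl : j = d m + 1 := by omega
        rw [hvt, hdt']
        omega
  have hpar : ∀ i, g < i → i ≤ g + (d m + 1) → p (v i) = v (i - 1) := by
    intro i hi hi'
    obtain ⟨j, rfl⟩ : ∃ j, i = g + (j + 1) := ⟨i - g - 1, by omega⟩
    rw [show g + (j + 1) - 1 = g + j by omega, hvp j (by omega)]
    by_cases hj : j + 1 ≤ d m
    · rw [hvp _ hj, ← Function.iterate_succ_apply' p, show (d m - (j + 1)).succ = d m - j by omega]
    · obtain rfl : j = d m := by omega
      rw [hvt, hpt, Nat.sub_self]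
      rfl
  have hinj : Set.InjOn v (Set.Icc 1 (g + (d m + 1))) := by
    rintro i ⟨hi1, hi2⟩ j ⟨hj1, hj2⟩ hij
    have h1 := hdepth i hi2
    have h2 := hdepth j hj2
    rw [hij, h2] at h1
    by_cases hi : i ≤ g
    · have hj : j ≤ g := by omega
      rw [hvc i hi, hvc j hj, h.c_eq_iff] at hij
      rcases hi.eq_or_lt with rfl | hi <;> rcases hj.eq_or_lt with rfl | hj
      · rfl
      · simp only [Nat.ModEq, Nat.mod_self, Nat.mod_eq_of_lt hj] at hij
        omega
      · simp only [Nat.ModEq, Nat.mod_self, Nat.mod_eq_of_lt hi] at hij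
        omega
      · exact hij.eq_of_lt_of_lt hi hj
    · omega
  have hanc : ∀ u, d u ≠ 0 → ¬ G.IsPendant u → ∃ i ∈ Set.Icc 1 (g + d m), v i = u := by
    intro u hu hp
    obtain ⟨r, L, k, hs, rfl, hd⟩ := h.exists_isStar u hu hp
    obtain rfl := hstar r L hs
    exact ⟨g + (d r - k), ⟨by omega, by omega⟩, by
      rw [hvp _ (by omega), show d r - (d r - k) = k by omega]⟩
  have hcyc : ∀ u, d u = 0 → ∃ i ∈ Set.Icc 1 g, v i = u := by
    intro u hu
    obtain ⟨i, rfl⟩ := (h.depth_eq_zero_iff u).1 hu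
    by_cases hi : i % g = 0
    · exact ⟨g, ⟨by omega, le_rfl⟩, by rw [hvc g le_rfl, h.c_eq_iff, Nat.ModEq, hi, Nat.mod_self]⟩
    · have := Nat.mod_lt i (show g > 0 by omega)
      exact ⟨i % g, ⟨by omega, by omega⟩, by
        rw [hvc _ (by omega), h.c_eq_iff]
        exact Nat.mod_modEq i g⟩
  refine ⟨v, ⟨h3, by omega, hinj, ?_, ?_, ?_⟩, hvm⟩
  · refine adj_iff_of_lt ?_
    rintro i ⟨hi1, hi2⟩ j ⟨hj1, hj2⟩ hij
    rw [lollipop_adj_iff hi1 hij]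
    by_cases hjg : g < j
    · have hdj : d (v j) ≠ 0 := by rw [hdepth j hj2]; omega
      have hiff : v i = p (v j) ↔ j = i + 1 := by
        rw [hpar j hjg hj2]
        refine ⟨fun h' => ?_, fun h' => by rw [h']; rfl⟩
        have := hinj ⟨hi1, hi2⟩ ⟨by omega, by omega⟩ h'
        omega
      constructor
      · intro hadj
        rcases h.adj_cases hdj hadj.symm with h1 | ⟨h1, h2⟩
        · have := hiff.1 h1
          omega
        · have := h.depth_parent _ h1
          rw [h2, hdepth i hi2, hdepth j hj2] at this
          omega
      · intro h'
        have : v i = p (v j) := hiff.2 (by omega)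
        exact this ▸ (h.adj_parent hdj).symm
    · rw [hvc i (by omega), hvc j (by omega)]
      constructor
      · intro hadj
        rcases h.adj_c_cases hadj with h1 | h1 | h1
        · rw [h.c_eq_iff] at h1
          left
          rcases (show j ≤ g by omega).eq_or_lt with rfl | hjg
          · by_contra hne
            have : i + 1 < j := by omega
            simp only [Nat.ModEq, Nat.mod_self, Nat.mod_eq_of_lt this] at h1
            omega
          · have := h1.eq_of_lt_of_lt hjg (by omega)
            omega
        · rw [h.c_eq_iff] at h1
          right
          have h2 := h1.add_right 1
          rw [show i + (g - 1) + 1 = i + g by omega] at h2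
          have h2 : j + 1 ≡ i [MOD g] := h2.trans (by simp [Nat.ModEq])
          rcases (show j ≤ g by omega).eq_or_lt with rfl | hjg
          · have h4 : 1 ≡ i [MOD j] := Nat.ModEq.trans (by simp [Nat.ModEq]) h2
            exact ⟨(h4.eq_of_lt_of_lt (by omega) hij).symm, rfl⟩
          · rcases (show j + 1 ≤ g by omega).eq_or_lt with h5 | h5
            · rw [← h5] at h2
              simp only [Nat.ModEq, Nat.mod_self, Nat.mod_eq_of_lt (show i < j + 1 by omega)] at h2
              omega
            · have := h2.eq_of_lt_of_lt h5 (by omega)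
              omega
        · exact absurd (h.depth_c j) h1.1
      · rintro (⟨-, rfl, -⟩ | ⟨rfl, rfl⟩)
        · exact h.adj_c i
        · have := h.adj_c j
          rw [add_comm j 1, h.c_add] at this
          exact this.symm
  · intro u hu
    have hu0 : d u ≠ 0 := by
      intro h0
      obtain ⟨i, hi, rfl⟩ := hcyc u h0
      exact hu ⟨i, ⟨hi.1, hi.2.trans (by omega)⟩, rfl⟩
    have hup : G.IsPendant u := by
      by_contra hup
      obtain ⟨i, hi, rfl⟩ := hanc u hu0 hup
      exact hu ⟨i, ⟨hi.1, hi.2.trans (by omega)⟩, rfl⟩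
    obtain ⟨i, hi, hiu⟩ : ∃ i ∈ Set.Icc 1 (g + d m), v i = p u := by
      by_cases h0 : d (p u) = 0
      · obtain ⟨i, hi, hiu⟩ := hcyc _ h0
        exact ⟨i, ⟨hi.1, hi.2.trans (by omega)⟩, hiu⟩
      · exact hanc _ h0 (h.not_isPendant_parent hu0)
    exact ⟨i, ⟨hi.1, hi.2⟩, by rw [hiu, h.neighborSet_of_isPendant hup]⟩
  · intro w hw
    exact hmulti w fun h' => hw (by rw [h', show g + (d m + 1) - 1 = g + d m by omega, hvm])

namespace IsFLabelling

variable {V : Type*} {G : SimpleGraph V} {g l : ℕ} {v : ℕ → V}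

theorem adj_cases (h : G.IsFLabelling g l v) {i : ℕ} (hi : i ∈ Set.Icc 1 (g + l)) {b : V}
    (hb : G.Adj (v i) b) :
    (∃ j ∈ Set.Icc 1 (g + l), b = v j ∧ (lollipop g l).Adj i j) ∨
      (i ≤ g + l - 1 ∧ G.neighborSet b = {v i}) := by
  by_cases hb' : b ∈ v '' Set.Icc 1 (g + l)
  · obtain ⟨j, hj, rfl⟩ := hb'
    exact Or.inl ⟨j, hj, rfl, (h.adj_iff i hi j hj).1 hb⟩
  · obtain ⟨j, hj, hN⟩ := h.attached b hb'
    have h1 := (adj_iff_of_neighborSet_eq hN _).1 hb.symm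
    have h2 := h.injOn hi ⟨hj.1, hj.2.trans (by omega)⟩ h1
    exact Or.inr ⟨h2 ▸ hj.2, h1 ▸ hN⟩

theorem adj_succ (h : G.IsFLabelling g l v) {i : ℕ} (hi : 1 ≤ i) (hi' : i + 1 ≤ g + l) :
    G.Adj (v i) (v (i + 1)) := by
  rw [h.adj_iff i ⟨hi, by omega⟩ (i + 1) ⟨by omega, hi'⟩, lollipop_adj_iff hi (Nat.lt_succ_self i)]
  exact Or.inl ⟨hi, rfl, hi'⟩

theorem neighborSet_last (h : G.IsFLabelling g l v) :
    G.neighborSet (v (g + l)) = {v (g + l - 1)} := by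
  have h3 := h.three_le
  have h1 := h.one_le
  ext b
  rw [mem_neighborSet, Set.mem_singleton_iff]
  constructor
  · intro hb
    rcases h.adj_cases ⟨by omega, le_rfl⟩ hb with ⟨j, hj, rfl, hadj⟩ | ⟨hle, -⟩
    · have hj2 := hj.2
      have hlt : j < g + l := lt_of_le_of_ne hj2 fun h' => (h' ▸ hadj).ne rfl
      rw [adj_comm, lollipop_adj_iff hj.1 hlt] at hadj
      congr 1
      omega
    · omega
  · rintro rfl
    have := h.adj_succ (i := g + l - 1) (by omega) (by omega)
    rw [show g + l - 1 + 1 = g + l by omega] at this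
    exact this.symm

theorem isSupport (h : G.IsFLabelling g l v) : G.IsSupport (v (g + l - 1)) := by
  have hN := h.neighborSet_last
  exact ⟨v (g + l), ((adj_iff_of_neighborSet_eq hN _).2 rfl).symm, isPendant_iff.2 ⟨_, hN⟩⟩

/-- For `l ≥ 2` the vertex `v (g + l - 1)` is off the cycle, so uniqueness of star centres
determines it in any labelling. -/
theorem isStar (h : G.IsFLabelling g l v) (hl : 2 ≤ l) :
    ∃ L, G.IsStar (v (g + l - 1)) (v (g + l - 2)) L := by
  have h3 := h.three_le
  have hN := h.neighborSet_last
  refine ⟨{b | G.Adj (v (g + l - 1)) b ∧ b ≠ v (g + l - 2)}, ?_, fun _ => Iff.rfl, ?_, ?_⟩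
  · have := h.adj_succ (i := g + l - 2) (by omega) (by omega)
    rw [show g + l - 2 + 1 = g + l - 1 by omega] at this
    exact this.symm
  · rintro b ⟨hb, hne⟩
    rcases h.adj_cases ⟨by omega, by omega⟩ hb with ⟨j, hj, rfl, hadj⟩ | ⟨-, h'⟩
    · rcases lt_or_gt_of_ne hadj.ne with hlt | hlt
      · rw [lollipop_adj_iff (by omega) hlt] at hadj
        obtain rfl : j = g + l := by omega
        exact hN
      · rw [adj_comm, lollipop_adj_iff hj.1 hlt] at hadj
        exact absurd (by congr 1; omega) hne
    · exact h'
  · refine ⟨v (g + l), ((adj_iff_of_neighborSet_eq hN _).2 rfl).symm, fun h' => ?_⟩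
    have := h.injOn ⟨by omega, le_rfl⟩ ⟨by omega, by omega⟩ h'
    omega

/-- An eigenvector for the least eigenvalue that vanishes at a path vertex of the labelling
vanishes at the next one. -/
theorem apply_succ_eq_zero [Fintype V] [DecidableEq V] (h : G.IsFLabelling g l v) {x : V → ℝ}
    (hx : G.signlessLapMatrix *ᵥ x = G.qMin • x) {i : ℕ} (hi : g ≤ i) (hi' : i + 1 ≤ g + l)
    (h0 : x (v i) = 0) : x (v (i + 1)) = 0 := by
  have h3 := h.three_le
  -- `B` is all that hangs beyond `v i`: later path vertices and the pendant vertices at them.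
  set B : Set V := {b | ∃ j ∈ Set.Icc (i + 1) (g + l), b = v j ∨ G.neighborSet b = {v j}} with hB
  have hne : ∀ j ∈ Set.Icc 1 (g + l), ∀ k ∈ Set.Icc 1 (g + l), v j = v k → j = k :=
    fun j hj k hk h' => h.injOn hj hk h'
  refine (branch_sign hx (B := B) (a := v (i + 1)) (u := v i) ⟨i + 1, ⟨le_rfl, hi'⟩, Or.inl rfl⟩
    ?_ (h.adj_succ (by omega) hi').symm ?_).2 h0
  · rintro ⟨j, ⟨hj1, hj2⟩, h' | h'⟩
    · have := hne _ ⟨by omega, by omega⟩ _ ⟨by omega, hj2⟩ h'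
      omega
    · have h1 := (adj_iff_of_neighborSet_eq h' _).1 (h.adj_succ (i := i - 1) (by omega)
        (by omega) |>.symm |> fun e => by rwa [show i - 1 + 1 = i by omega] at e)
      have := hne _ ⟨by omega, by omega⟩ _ ⟨by omega, hj2⟩ h1
      omega
  · rintro b ⟨j, ⟨hj1, hj2⟩, rfl | h'⟩ z hz hbz
    · rcases h.adj_cases ⟨by omega, hj2⟩ hbz with ⟨k, ⟨hk1, hk2⟩, rfl, hadj⟩ | ⟨-, h1⟩
      · have hki : k ≤ i := by
          by_contra hki
          exact hz ⟨k, ⟨by omega, hk2⟩, Or.inl rfl⟩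
        rw [adj_comm, lollipop_adj_iff (by omega) (by omega)] at hadj
        obtain rfl : k = i := by omega
        obtain rfl : j = k + 1 := by omega
        exact ⟨rfl, rfl⟩
      · exact absurd ⟨j, ⟨hj1, hj2⟩, Or.inr h1⟩ hz
    · have := (adj_iff_of_neighborSet_eq h' z).1 hbz
      exact absurd ⟨j, ⟨hj1, hj2⟩, Or.inl this⟩ hz

theorem ne_zero_of_ne_zero [Fintype V] [DecidableEq V] (h : G.IsFLabelling g l v) {x : V → ℝ}
    (hx : G.signlessLapMatrix *ᵥ x = G.qMin • x) (h0 : x (v (g + l - 1)) ≠ 0) : x (v g) ≠ 0 := by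
  intro hg
  have h1 := h.one_le
  have : ∀ j, g + j ≤ g + l → x (v (g + j)) = 0 := by
    intro j
    induction j with
    | zero => exact fun _ => hg
    | succ j ih =>
      exact fun hj => h.apply_succ_eq_zero hx (i := g + j) (by omega) (by omega) (ih (by omega))
  have h2 := this (l - 1) (by omega)
  rw [show g + (l - 1) = g + l - 1 by omega] at h2
  exact h0 h2

end IsFLabelling

/-! ### Minimizers -/

section Minimizer

variable {n γ g : ℕ} {G : SimpleGraph (Fin n)} {x : Fin n → ℝ} {m : Fin n}

/-- Otherwise the leaves or the whole star could be moved to `m` within the class. Both moves lower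
`qMin`, since `|x u| ≤ |x r| ≤ |x m|`. -/
theorem eq_of_isStar (hG : G ∈ nonbipartiteUnicyclic n γ g)
    (hmin : ∀ H ∈ nonbipartiteUnicyclic n γ g, G.qMin ≤ H.qMin) (hx : G.IsUnitQMinEigenvector x)
    (hm : G.IsSupport m) (hmax : ∀ w, G.IsSupport w → |x w| ≤ |x m|) (hm0 : x m ≠ 0)
    {r u : Fin n} {L : Set (Fin n)} (hs : G.IsStar r u L) : r = m := by
  have hq := G.qMin_pos hG.1.1 hG.2.1
  obtain ⟨l, hl⟩ := hs.nonempty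
  obtain ⟨t, hmt, ht⟩ := hm
  obtain ⟨w, hw⟩ := isPendant_iff.1 ht
  obtain rfl := (adj_iff_of_neighborSet_eq hw _).1 hmt.symm
  have hr : |x r| ≤ |x m| :=
    hmax r ⟨l, ((hs.mem_iff l).1 hl).1, isPendant_iff.2 ⟨r, hs.neighborSet_eq l hl⟩⟩
  have hur := hs.abs_le hx.1 hq
  have hxm := abs_pos.2 hm0
  have hqr : 0 ≤ G.qMin * |x r| := mul_nonneg hq.le (abs_nonneg _)
  by_contra hrm
  -- If `u = m`, `IsStar.abs_le` gives `|x m| + qMin * |x r| ≤ |x r| ≤ |x m|`, impossible as `x m ≠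
  -- 0`.
  have hum : u ≠ m := by
    rintro rfl
    have : 0 < G.qMin * |x r| := mul_pos hq (by linarith)
    linarith
  have hmL : m ∉ L := by
    intro h'
    have h1 := hs.neighborSet_eq m h'
    have h2 : t = r := (adj_iff_of_neighborSet_eq h1 t).1 hmt
    rw [h2] at hw
    exact hum ((adj_iff_of_neighborSet_eq hw u).1 hs.adj)
  have hmB : m ∉ insert r L := fun h' => h'.elim (fun h' => hrm h'.symm) hmL
  rcases hs.dominationNumber_relocate hw (Ne.symm hrm) hum.symm hmL with hγ | hγ
  · obtain ⟨s, hsgn⟩ := exists_isSignPattern_leaves hx.1 hs.neighborSet_eq hs.notMem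
    have hlt := hsgn.qMin_relocate_lt hs.isAttached_leaves hmL hx hq hrm hr hm0 hl
      ((hs.adj_iff hl r).2 rfl)
    have := hmin _ (hs.isAttached_leaves.relocate_mem_nonbipartiteUnicyclic hmL
      hs.bridgesAt_leaves hG (hγ.trans hG.2.2.1))
    linarith
  · obtain ⟨s, hsgn⟩ := hs.exists_isSignPattern hx.1
    have hlt := hsgn.qMin_relocate_lt hs.isAttached_star hmB hx hq hum (by linarith) hm0
      (Set.mem_insert r L) hs.adj
    have := hmin _ (hs.isAttached_star.relocate_mem_nonbipartiteUnicyclic hmB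
      hs.bridgesAt_star hG (hγ.trans hG.2.2.1))
    linarith

/-- Otherwise one pendant vertex at `w` could move to `m`; the second keeps `w` a support vertex, so
the domination number stays the same. -/
theorem eq_of_two_le_ncard (hG : G ∈ nonbipartiteUnicyclic n γ g)
    (hmin : ∀ H ∈ nonbipartiteUnicyclic n γ g, G.qMin ≤ H.qMin) (hx : G.IsUnitQMinEigenvector x)
    (hm : G.IsSupport m) (hmp : ¬ G.IsPendant m) (hmax : ∀ w, G.IsSupport w → |x w| ≤ |x m|)
    (hm0 : x m ≠ 0) {w : Fin n} (hwp : ¬ G.IsPendant w)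
    (hw : 2 ≤ (G.pendantNeighborSet w).ncard) : w = m := by
  have hq := G.qMin_pos hG.1.1 hG.2.1
  obtain ⟨t, hmt, ht⟩ := hm
  obtain ⟨a, ⟨hwa, ha⟩, b, ⟨hwb, hb⟩, hab⟩ := (Set.one_lt_ncard (Set.toFinite _)).1 hw
  have hN : ∀ {z y}, G.Adj z y → G.IsPendant y → G.neighborSet y = {z} := by
    intro z y hzy hy
    obtain ⟨w', hw'⟩ := isPendant_iff.1 hy
    rwa [(adj_iff_of_neighborSet_eq hw' z).1 hzy.symm]
  have hNa := hN hwa ha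
  by_contra hwm
  have hma : m ∉ ({a} : Set (Fin n)) := fun h' => hmp (Set.mem_singleton_iff.1 h' ▸ ha)
  obtain ⟨s, hsgn⟩ := exists_isSignPattern_leaves hx.1 (L := {a}) (r := w)
    (by rintro y rfl; exact hNa) (isAttached_singleton hNa).notMem
  have hlt := hsgn.qMin_relocate_lt (isAttached_singleton hNa) hma hx hq hwm
    (hmax w ⟨a, hwa, ha⟩) hm0 (Set.mem_singleton a) hwa.symm
  have hγ := dominationNumber_relocate_pendant hNa (hN hwb hb) (hN hmt ht) hab hwm hma
    (fun h' => hmp (h' ▸ hb)) (fun h' => hwp (h' ▸ ht))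
  have hbr : G.BridgesAt {a} w := by
    rintro y rfl _
    refine ⟨{y}, subset_rfl, rfl, ?_⟩
    rintro b rfl z _ hbz
    exact ⟨rfl, (adj_iff_of_neighborSet_eq hNa z).1 hbz⟩
  have := hmin _ ((isAttached_singleton hNa).relocate_mem_nonbipartiteUnicyclic hma hbr hG
    (hγ.trans hG.2.2.1))
  linarith

/-- At a minimizer the labelling can be chosen with its end at a support vertex where the
eigenvector is largest, and the parameter `l` does not depend on the eigenvector. -/
theorem exists_isFLabelling_of_minimal (hg : g + 1 ≤ n) (hG : G ∈ nonbipartiteUnicyclic n γ g)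
    (hmin : ∀ H ∈ nonbipartiteUnicyclic n γ g, G.qMin ≤ H.qMin) :
    ∃ l : ℕ, (∃ v : ℕ → Fin n, G.IsFLabelling g l v) ∧
      ∀ x : Fin n → ℝ, G.IsUnitQMinEigenvector x →
        (∃ v : ℕ → Fin n, G.IsFLabelling g l v ∧ 0 < |x (v g)| ∧
          IsGreatest ((fun w => |x w|) '' {w | G.IsSupport w}) |x (v (g + l - 1))|) ∧
        (∀ v : ℕ → Fin n, G.IsFLabelling g l v →
          (2 ≤ l ∨ 2 ≤ (G.pendantNeighborSet (v g)).ncard) →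
          0 < |x (v g)| ∧
          IsGreatest ((fun w => |x w|) '' {w | G.IsSupport w}) |x (v (g + l - 1))|) := by
  have hq := G.qMin_pos hG.1.1 hG.2.1
  obtain ⟨c, p, d, hF⟩ := exists_cycleForest hG.1 (not_isAcyclic_of_not_isBipartite hG.2.1)
  rw [hG.2.2.2] at hF
  obtain ⟨v₀, hv₀⟩ := hF.exists_depth_ne_zero (by simpa using hg)
  have hmax : ∀ x, G.IsUnitQMinEigenvector x →
      ∃ m, G.IsSupport m ∧ (∀ w, G.IsSupport w → |x w| ≤ |x m|) ∧ x m ≠ 0 := by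
    intro x hx
    obtain ⟨w, hw, hw0⟩ := hF.exists_isSupport_ne_zero hx hq hv₀
    obtain ⟨m, hm, hmm⟩ := Set.exists_max_image {w | G.IsSupport w} (fun w => |x w|)
      (Set.toFinite _) ⟨w, hw⟩
    refine ⟨m, hm, hmm, fun h0 => hw0 ?_⟩
    have := hmm w hw
    simpa [h0] using this
  have hlab : ∀ x m, G.IsUnitQMinEigenvector x → G.IsSupport m →
      (∀ w, G.IsSupport w → |x w| ≤ |x m|) → x m ≠ 0 →
      ∃ v, G.IsFLabelling g (d m + 1) v ∧ v (g + d m) = m := by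
    intro x m hx hm hmm hm0
    refine hF.exists_isFLabelling hm
      (fun r L hs => eq_of_isStar hG hmin hx hm hmm hm0 hs) fun w hw => ?_
    by_contra hlt
    rw [not_le] at hlt
    have hwp : ¬ G.IsPendant w := by
      obtain ⟨a, ha⟩ : G.IsSupport w := by
        by_contra hn
        rw [IsSupport, Set.not_nonempty_iff_eq_empty] at hn
        simp [hn] at hlt
      exact hF.not_isPendant_of_isSupport ⟨a, ha⟩
    exact hw (eq_of_two_le_ncard hG hmin hx hm (hF.not_isPendant_of_isSupport hm) hmm hm0 hwp hlt)
  -- A maximizing support vertex off the cycle forces a star to exist, and its centre is the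
  -- maximizer for every eigenvector. So the depth of the maximizer, and with it `l`, is independent
  -- of `x`.
  have hdepth : ∀ x m x' m', G.IsUnitQMinEigenvector x → G.IsSupport m →
      (∀ w, G.IsSupport w → |x w| ≤ |x m|) → x m ≠ 0 → G.IsUnitQMinEigenvector x' →
      G.IsSupport m' → (∀ w, G.IsSupport w → |x' w| ≤ |x' m'|) → x' m' ≠ 0 → d m ≠ 0 →
      m = m' := by
    intro x m x' m' hx hm hmm hm0 hx' hm' hmm' hm0' hd
    obtain ⟨r, L, -, hs, -, -⟩ := hF.exists_isStar m hd (hF.not_isPendant_of_isSupport hm)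
    rw [← eq_of_isStar hG hmin hx hm hmm hm0 hs, ← eq_of_isStar hG hmin hx' hm' hmm' hm0' hs]
  have := hG.1.1.nonempty
  obtain ⟨x₀, hx₀⟩ := G.exists_isUnitQMinEigenvector
  obtain ⟨m₀, hm₀, hmm₀, hm₀0⟩ := hmax x₀ hx₀
  refine ⟨d m₀ + 1, (hlab x₀ m₀ hx₀ hm₀ hmm₀ hm₀0).imp fun v hv => hv.1, fun x hx => ?_⟩
  obtain ⟨m, hm, hmm, hm0⟩ := hmax x hx
  have hdm : d m = d m₀ := by
    by_cases h1 : d m = 0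
    · by_cases h2 : d m₀ = 0
      · rw [h1, h2]
      · rw [hdepth x₀ m₀ x m hx₀ hm₀ hmm₀ hm₀0 hx hm hmm hm0 h2]
    · rw [hdepth x m x₀ m₀ hx hm hmm hm0 hx₀ hm₀ hmm₀ hm₀0 h1]
  have hgr : IsGreatest ((fun w => |x w|) '' {w | G.IsSupport w}) |x m| :=
    ⟨⟨m, hm, rfl⟩, by rintro _ ⟨w, hw, rfl⟩; exact hmm w hw⟩
  have hfin : ∀ v, G.IsFLabelling g (d m₀ + 1) v → v (g + (d m₀ + 1) - 1) = m →
      0 < |x (v g)| ∧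
        IsGreatest ((fun w => |x w|) '' {w | G.IsSupport w}) |x (v (g + (d m₀ + 1) - 1))| := by
    intro v hv hvm
    exact ⟨abs_pos.2 (hv.ne_zero_of_ne_zero hx.1 (hvm ▸ hm0)), hvm ▸ hgr⟩
  refine ⟨?_, fun v hv hcase => hfin v hv ?_⟩
  · obtain ⟨v, hv, hvm⟩ := hlab x m hx hm hmm hm0
    rw [hdm] at hv hvm
    exact ⟨v, hv, hfin v hv hvm⟩
  -- The end of the labelling is `m`: as a star centre if `l ≥ 2`, and by its two pendant neighbours
  -- if `l = 1`.
  · by_cases hl : 2 ≤ d m₀ + 1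
    · obtain ⟨L, hL⟩ := hv.isStar hl
      exact eq_of_isStar hG hmin hx hm hmm hm0 hL
    · have h2 := hcase.resolve_left hl
      have h1 : g + (d m₀ + 1) - 1 = g := by omega
      have hsup := hv.isSupport
      rw [h1] at hsup ⊢
      exact eq_of_two_le_ncard hG hmin hx hm (hF.not_isPendant_of_isSupport hm) hmm hm0
        (hF.not_isPendant_of_isSupport hsup) h2

end Minimizer

end SimpleGraph

theorem theorem3p2 (n γ g : ℕ) (hg : g + 1 ≤ n)
    (hne : (SimpleGraph.nonbipartiteUnicyclic n γ g).Nonempty) :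
    (∃ G ∈ SimpleGraph.nonbipartiteUnicyclic n γ g,
      (∀ H ∈ SimpleGraph.nonbipartiteUnicyclic n γ g, G.qMin ≤ H.qMin) ∧
      ∃ (l : ℕ) (v : ℕ → Fin n), G.IsFLabelling g l v) ∧
    ∀ G ∈ SimpleGraph.nonbipartiteUnicyclic n γ g,
      (∀ H ∈ SimpleGraph.nonbipartiteUnicyclic n γ g, G.qMin ≤ H.qMin) →
      ∃ l : ℕ, (∃ v : ℕ → Fin n, G.IsFLabelling g l v) ∧
        ∀ x : Fin n → ℝ, G.IsUnitQMinEigenvector x →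
          (∃ v : ℕ → Fin n, G.IsFLabelling g l v ∧ 0 < |x (v g)| ∧
            IsGreatest ((fun w => |x w|) '' {w | G.IsSupport w}) |x (v (g + l - 1))|) ∧
          (∀ v : ℕ → Fin n, G.IsFLabelling g l v →
            (2 ≤ l ∨ 2 ≤ (G.pendantNeighborSet (v g)).ncard) →
            0 < |x (v g)| ∧
            IsGreatest ((fun w => |x w|) '' {w | G.IsSupport w}) |x (v (g + l - 1))|) := by
  refine ⟨?_, fun G hG hmin => SimpleGraph.exists_isFLabelling_of_minimal hg hG hmin⟩
  obtain ⟨G, hG, hmin⟩ := Set.exists_min_image (SimpleGraph.nonbipartiteUnicyclic n γ g)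
    (fun G => G.qMin) (Set.toFinite _) hne
  obtain ⟨l, ⟨v, hv⟩, -⟩ := SimpleGraph.exists_isFLabelling_of_minimal hg hG hmin
  exact ⟨G, hG, hmin, l, v, hv⟩
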